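/- **Setting.** Let $W$ be a complete Noetherian local commutative ring whose residue field $k$ has characteristic $p>0$. Let $\hat{\mathcal C}_W$ be the category of complete Noetherian local $W$-algebras $A$ with residue field $k$ (the structure map $W\to A$ is local and induces an isomorphism on residue fields), with $W$-algebra homomorphisms as morphisms. Let $\Gamma$ be a profinite group such that every open subgroup $J$ of finite index in $\Gamma$ has only finitely many continuous homomorphisms $J\to\mathbb Z/p$. Let $V$ be a finite dimensional $k$-vector space with a $k$-linear action of $\Gamma$ given by a continuous homomorphism from $\Gamma$ to the discrete group $\mathrm{Aut}_k(V)$. **Deformations.** A lift of $V$ over $A\in\hat{\mathcal C}_W$ is a pair $(M,\phi)$, where $M$ is a finitely generated free $A$-module with a continuous $A$-linear action of $\Gamma$ (for the $\mathfrak m_A$-adic topology on $M$) and $\phi\colon k\otimes_A M\to V$ is a $\Gamma$-equivariant isomorphism of $k$-vector spaces. Let $\mathrm{Def}_V(A)$ be the set of isomorphism classes of lifts of $V$ over $A$. For $\alpha\colon A\to A'$ in $\hat{\mathcal C}_W$, let $\mathrm{Def}_V(\alpha)[M,\phi]=[A'\otimes_{A,\alpha}M,\phi_\alpha]$, where $\phi_\alpha$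 is the composition $k\otimes_{A'}(A'\otimes_{A,\alpha}M)\cong k\otimes_A M\xrightarrow{\phi}V$. A ring $R\in\hat{\mathcal C}_W$ is a versal deformation ring of $V$, written $R=R_W(\Gamma,V)$, if there is a lift $(U,\phi_U)$ of $V$ over $R$ such that the map $$f_A\colon \mathrm{Hom}_{\hat{\mathcal C}_W}(R,A)\to \mathrm{Def}_V(A),\qquad \alpha\mapsto \mathrm{Def}_V(\alpha)[U,\phi_U]$$ is surjective for all $A\in\hat{\mathcal C}_W$ and bijective for $A=k[\epsilon]$, the ring of dual numbers, on which $W$ acts through $k$. **Theorem 2.1.** Let $W\to W'$ be a local homomorphism of complete Noetherian local rings, and let $k'$ be the residue field of $W'$. Let $R=R_W(\Gamma,V)$ be a versal deformation ring of $V$. Let $\mathfrak m$ be the maximal ideal of $W'\otimes_W R$ that is the kernel of the canonical homomorphism $W'\otimes_W R\to k'$, $w'\otimes r\mapsto \overline{w'}\,\overline{r}$. Then the versal deformation ring $R_{W'}(\Gamma,V\otimes_k k')$ is the completion of $W'\otimes_W R$ with respect to $\mathfrak m$. That is, this completion is a complete Noetherian local $W'$-algebra with residue field $k'$, and a ring $R'\in\hat{\mathcal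 C}_{W'}$ is a versal deformation ring of the representation $V\otimes_k k'$ if and only if it is isomorphic to this completion as a $W'$-algebra. -/

import Mathlib

open IsLocalRing TensorProduct

universe u v w

/-- `A` is an object of the category `Ĉ_W`: a complete Noetherian local `W`-algebra
whose residue field is `k = W/𝔪_W`, i.e. the structure map `W → A` is local and induces an
isomorphism on residue fields. -/
class IsCoefficientAlgebra (W : Type*) [CommRing W] [IsLocalRing W]
    (A : Type*) [CommRing A] [Algebra W A] : Prop
    extends IsLocalRing A, IsNoetherianRing A, IsLocalHom (algebraMap W A) where
  isAdicComplete : IsAdicComplete (maximalIdeal A) A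
  bijective_residue : Function.Bijective (ResidueField.map (algebraMap W A))

/-- The objects of `Ĉ_W`, bundled. The morphisms are the `W`-algebra homomorphisms. -/
structure CoefficientAlgebra (W : Type u) [CommRing W] [IsLocalRing W] : Type (u + 1) where
  carrier : Type u
  [commRing : CommRing carrier]
  [algebra : Algebra W carrier]
  [isCoefficientAlgebra : IsCoefficientAlgebra W carrier]

namespace CoefficientAlgebra

variable {W : Type u} [CommRing W] [IsLocalRing W]

instance : CoeSort (CoefficientAlgebra W) (Type u) := ⟨carrier⟩

attribute [instance] commRing algebra isCoefficientAlgebra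

/-- The residue map `A → A/𝔪_A ≅ k`, as a homomorphism of `W`-algebras. -/
noncomputable def residueMap (A : CoefficientAlgebra W) : A →ₐ[W] ResidueField W where
  toRingHom := ((RingEquiv.ofBijective (ResidueField.map (algebraMap W A))
    IsCoefficientAlgebra.bijective_residue).symm : ResidueField A →+* ResidueField W).comp
      (residue A)
  commutes' x := by
    change (RingEquiv.ofBijective (ResidueField.map (algebraMap W A)) _).symm
      (residue A (algebraMap W A x)) = residue W x
    rw [RingEquiv.symm_apply_eq]
    exact (ResidueField.map_residue _ _).symm

/-- `k` is an algebra over every object of `Ĉ_W` through the residue map. -/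
noncomputable instance (A : CoefficientAlgebra W) : Algebra A (ResidueField W) :=
  A.residueMap.toRingHom.toAlgebra

theorem algebraMap_residueField (A : CoefficientAlgebra W) (a : A) :
    algebraMap A (ResidueField W) a = A.residueMap a := rfl

theorem residueMap_surjective (A : CoefficientAlgebra W) : Function.Surjective A.residueMap := by
  intro y
  obtain ⟨x, rfl⟩ := residue_surjective y
  exact ⟨algebraMap W A x, A.residueMap.commutes x⟩

theorem residueMap_eq_zero_iff (A : CoefficientAlgebra W) (a : A) :
    A.residueMap a = 0 ↔ a ∈ maximalIdeal A := by
  have h : A.residueMap a = 0 ↔ residue A a = 0 :=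
    map_eq_zero_iff _ (RingEquiv.ofBijective (ResidueField.map (algebraMap W A))
      IsCoefficientAlgebra.bijective_residue).symm.injective
  rw [h, residue_eq_zero_iff]

/-- Every `W`-algebra homomorphism between objects of `Ĉ_W` induces the identity on `k`. -/
theorem residueMap_comp {A B : CoefficientAlgebra W} (α : A →ₐ[W] B) (a : A) :
    B.residueMap (α a) = A.residueMap a := by
  -- both maps are `W`-algebra surjections onto `k`
  obtain ⟨x, hx⟩ := residue_surjective (A.residueMap a)
  have hm : a - algebraMap W A x ∈ maximalIdeal A := by
    rw [← residueMap_eq_zero_iff, map_sub, AlgHom.commutes, sub_eq_zero, ← hx]; rfl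
  have hker : RingHom.ker (B.residueMap.comp α) = maximalIdeal A := by
    apply IsLocalRing.eq_maximalIdeal
    apply RingHom.ker_isMaximal_of_surjective
    intro y
    obtain ⟨z, rfl⟩ := residue_surjective y
    exact ⟨algebraMap W A z, AlgHom.commutes _ z⟩
  have h : (B.residueMap.comp α) (a - algebraMap W A x) = 0 := by
    rw [← RingHom.mem_ker, hker]; exact hm
  rw [map_sub, AlgHom.commutes, sub_eq_zero] at h
  exact h.trans hx

/-- The dual numbers `k[ε]`, on which `W` acts through `k`, as an object of `Ĉ_W`. -/
noncomputable def dualNumber (W : Type u) [CommRing W] [IsLocalRing W] : CoefficientAlgebra W :=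
  haveI hloc : IsLocalHom (algebraMap W (DualNumber (ResidueField W))) := by
    constructor
    intro x hx
    have h : IsUnit (residue W x) := by
      simpa using hx.map (TrivSqZeroExt.fstHom (ResidueField W) (ResidueField W) (ResidueField W))
    exact isUnit_of_map_unit (residue W) x h
  haveI : IsArtinianRing (DualNumber (ResidueField W)) :=
    haveI : Module.Finite (ResidueField W) (DualNumber (ResidueField W)) :=
      inferInstanceAs (Module.Finite (ResidueField W) (ResidueField W × ResidueField W))
    IsArtinianRing.of_finite (ResidueField W) _
  { carrier := DualNumber (ResidueField W)
    isCoefficientAlgebra :=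
      { toIsLocalHom := hloc
        isAdicComplete := inferInstance
        bijective_residue := by
          refine ⟨RingHom.injective _, fun y => ?_⟩
          obtain ⟨z, rfl⟩ := residue_surjective y
          obtain ⟨x, hx⟩ := residue_surjective z.fst
          refine ⟨residue W x, ?_⟩
          rw [ResidueField.map_residue, ← sub_eq_zero, ← map_sub, residue_eq_zero_iff,
            DualNumber.maximalIdeal_eq_span_singleton_eps, Ideal.mem_span_singleton,
            ← DualNumber.fst_eq_zero_iff_eps_dvd]
          rw [TrivSqZeroExt.fst_sub, ← hx]
          exact sub_self _ } }

end CoefficientAlgebra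

/-- A linear action of `Γ` on a module `M` over a local ring `A` is continuous if the map
`Γ × M → M` is continuous for the `𝔪_A`-adic topology on `M`. -/
def IsContinuousAction {Γ : Type*} [Group Γ] [TopologicalSpace Γ] {A : Type*} [CommRing A]
    [IsLocalRing A] {M : Type*} [AddCommGroup M] [Module A M] (σ : Representation A Γ M) : Prop :=
  letI : TopologicalSpace M := (maximalIdeal A).adicModuleTopology M
  Continuous fun x : Γ × M => σ x.1 x.2

theorem hasBasis_nhds_adicModuleTopology {A : Type*} [CommRing A] (I : Ideal A)
    {M : Type*} [AddCommGroup M] [Module A M] (m : M) :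
    (@nhds M (I.adicModuleTopology M) m).HasBasis (fun _ : ℕ => True)
      fun n => {y | y - m ∈ I ^ n • (⊤ : Submodule A M)} := by
  let : TopologicalSpace A := I.adicTopology
  have h := (I.ringFilterBasis.moduleFilterBasis
    (I.adic_module_basis M)).toAddGroupFilterBasis.nhds_hasBasis m
  refine ⟨fun U => ?_⟩
  refine Iff.trans h.mem_iff ⟨?_, ?_⟩
  · rintro ⟨_, ⟨n, rfl⟩, hU⟩
    refine ⟨n, trivial, fun y hy => hU ⟨y - m, hy, by simp⟩⟩
  · rintro ⟨n, -, hU⟩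
    refine ⟨_, ⟨n, rfl⟩, ?_⟩
    rintro _ ⟨z, hz, rfl⟩
    exact hU (by simpa using hz)

/-- Continuity can be tested on each vector, near the identity of `Γ`. -/
theorem isContinuousAction_iff {Γ : Type*} [Group Γ] [TopologicalSpace Γ] [IsTopologicalGroup Γ]
    {A : Type*} [CommRing A] [IsLocalRing A] {M : Type*} [AddCommGroup M] [Module A M]
    (σ : Representation A Γ M) :
    IsContinuousAction σ ↔ ∀ (n : ℕ) (m : M), ∀ᶠ g in nhds (1 : Γ),
      σ g m - m ∈ maximalIdeal A ^ n • (⊤ : Submodule A M) := by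
  let : TopologicalSpace M := (maximalIdeal A).adicModuleTopology M
  have stable : ∀ (n : ℕ) (g : Γ) (m : M), m ∈ maximalIdeal A ^ n • (⊤ : Submodule A M) →
      σ g m ∈ maximalIdeal A ^ n • (⊤ : Submodule A M) := by
    intro n g m hm
    have h := Submodule.mem_map_of_mem (f := σ g) hm
    rw [Submodule.map_smul''] at h
    exact smul_mono_right (maximalIdeal A ^ n) (le_top (a := Submodule.map (σ g) ⊤)) h
  constructor
  · intro h n m
    have h1 : Continuous fun g : Γ => σ g m :=
      Continuous.comp (h : Continuous fun x : Γ × M => σ x.1 x.2) (Continuous.prodMk_left m)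
    have h2 := h1.tendsto 1
    rw [map_one] at h2
    exact ((hasBasis_nhds_adicModuleTopology (maximalIdeal A) m).tendsto_right_iff.mp h2) n trivial
  · intro h
    change Continuous fun x : Γ × M => σ x.1 x.2
    rw [continuous_iff_continuousAt]
    rintro ⟨g₀, m₀⟩
    refine (hasBasis_nhds_adicModuleTopology (maximalIdeal A) _).tendsto_right_iff.mpr ?_
    intro n _
    have h1 : Filter.Tendsto (fun g => g₀⁻¹ * g) (nhds g₀) (nhds 1) := by
      have : Continuous fun g : Γ => g₀⁻¹ * g := continuous_const.mul continuous_id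
      simpa using this.tendsto g₀
    have h2 := h1.eventually (h n m₀)
    have h3 : ∀ᶠ m in nhds m₀, m - m₀ ∈ maximalIdeal A ^ n • (⊤ : Submodule A M) :=
      (hasBasis_nhds_adicModuleTopology (maximalIdeal A) m₀).mem_of_mem (i := n) trivial
    rw [nhds_prod_eq]
    filter_upwards [h2.prod_mk h3] with x hx
    have e : σ x.1 x.2 - σ g₀ m₀ =
        σ x.1 (x.2 - m₀) + σ g₀ (σ (g₀⁻¹ * x.1) m₀ - m₀) := by
      have : σ g₀ (σ (g₀⁻¹ * x.1) m₀) = σ x.1 m₀ := by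
        rw [← Module.End.mul_apply, ← map_mul, mul_inv_cancel_left]
      rw [map_sub, map_sub, this]; abel
    change σ x.1 x.2 - σ g₀ m₀ ∈ _
    rw [e]
    exact add_mem (stable _ _ _ hx.2) (stable _ _ _ hx.1)

/-- Extension of scalars of a representation. -/
noncomputable def Representation.extendScalars {A : Type*} [CommRing A] {Γ : Type*} [Monoid Γ]
    {M : Type*} [AddCommGroup M] [Module A M] (σ : Representation A Γ M)
    (B : Type*) [CommRing B] [Algebra A B] : Representation B Γ (B ⊗[A] M) :=
  (Module.End.baseChangeHom A B M : Module.End A M →* Module.End B (B ⊗[A] M)).comp σ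

section Deformations

variable {W : Type u} [CommRing W] [IsLocalRing W] {Γ : Type v} [Group Γ] [TopologicalSpace Γ]
  {V : Type w} [AddCommGroup V] [Module (ResidueField W) V]

/-- A lift of the representation `ρ` of `Γ` on `V` over an object `A` of `Ĉ_W`: a finitely
generated free `A`-module `M` with a continuous `A`-linear action of `Γ`, and a
`Γ`-equivariant isomorphism `φ : k ⊗_A M ≅ V` of `k`-vector spaces. -/
structure Lift (ρ : Representation (ResidueField W) Γ V) (A : CoefficientAlgebra W) :
    Type (max (u + 1) v w) where
  M : Type u
  [addCommGroup : AddCommGroup M]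
  [module : Module A M]
  [finite : Module.Finite A M]
  [free : Module.Free A M]
  σ : Representation A Γ M
  continuous : IsContinuousAction σ
  φ : (ResidueField W) ⊗[A] M ≃ₗ[ResidueField W] V
  equivariant : ∀ (g : Γ) (x : (ResidueField W) ⊗[A] M),
    φ (σ.extendScalars (ResidueField W) g x) = ρ g (φ x)

namespace Lift

attribute [instance] addCommGroup module finite free

variable {ρ : Representation (ResidueField W) Γ V}

/-- Two lifts are isomorphic if there is a `Γ`-equivariant `A`-linear isomorphism between them
that is compatible with the identifications with `V`. -/
def IsIsomorphic {A : CoefficientAlgebra W} (L L' : Lift ρ A) : Prop :=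
  ∃ f : L.M ≃ₗ[A] L'.M, (∀ (g : Γ) (m : L.M), f (L.σ g m) = L'.σ g (f m)) ∧
    ∀ x : (ResidueField W) ⊗[A] L.M,
      L'.φ ((f : L.M →ₗ[A] L'.M).baseChange (ResidueField W) x) = L.φ x

instance setoid (ρ : Representation (ResidueField W) Γ V) (A : CoefficientAlgebra W) :
    Setoid (Lift ρ A) where
  r := IsIsomorphic
  iseqv :=
    { refl := fun L => ⟨LinearEquiv.refl A L.M, fun _ _ => rfl, fun x => by
        change L.φ ((LinearMap.id : L.M →ₗ[A] L.M).baseChange (ResidueField W) x) = _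
        rw [LinearMap.baseChange_id]; rfl⟩
      symm := by
        rintro L L' ⟨f, hf, hφ⟩
        refine ⟨f.symm, fun g m => ?_, fun x => ?_⟩
        · rw [LinearEquiv.symm_apply_eq, hf, LinearEquiv.apply_symm_apply]
        · rw [← hφ, ← LinearMap.comp_apply, ← LinearMap.baseChange_comp, LinearEquiv.comp_coe,
            LinearEquiv.symm_trans_self, LinearEquiv.refl_toLinearMap, LinearMap.baseChange_id]
          rfl
      trans := by
        rintro L L' L'' ⟨f, hf, hφ⟩ ⟨f', hf', hφ'⟩
        refine ⟨f.trans f', fun g m => ?_, fun x => ?_⟩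
        · simp [hf, hf']
        · rw [← hφ, ← hφ', ← LinearMap.comp_apply, ← LinearMap.baseChange_comp,
            LinearEquiv.comp_coe] }

/-- The base change `(A' ⊗_{A,α} M, φ_α)` of a lift `(M, φ)` over `A` along a morphism
`α : A → A'` of `Ĉ_W`, where `φ_α` is the composition
`k ⊗_{A'} (A' ⊗_{A,α} M) ≅ k ⊗_A M ≅ V`. -/
noncomputable def baseChange [IsTopologicalGroup Γ] {A A' : CoefficientAlgebra W} (L : Lift ρ A)
    (α : A →ₐ[W] A') : Lift ρ A' :=
  letI : Algebra A A' := α.toRingHom.toAlgebra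
  haveI : IsScalarTower A A' (ResidueField W) :=
    .of_algebraMap_eq fun a => (CoefficientAlgebra.residueMap_comp α a).symm
  { M := A' ⊗[A] L.M
    σ := L.σ.extendScalars A'
    continuous := by
      rw [isContinuousAction_iff]
      intro n x
      induction x with
      | zero => simp
      | add x y hx hy =>
        filter_upwards [hx, hy] with g hgx hgy
        rw [map_add, add_sub_add_comm]
        exact add_mem hgx hgy
      | tmul a m =>
        filter_upwards [(isContinuousAction_iff L.σ).mp L.continuous n m] with g hg
        have e : L.σ.extendScalars A' g (a ⊗ₜ[A] m) - a ⊗ₜ[A] m = a ⊗ₜ[A] (L.σ g m - m) := by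
          rw [TensorProduct.tmul_sub]; rfl
        rw [e]
        refine Submodule.smul_induction_on
          (p := fun y => a ⊗ₜ[A] y ∈ maximalIdeal A' ^ n • (⊤ : Submodule A' (A' ⊗[A] L.M)))
          hg ?_ ?_
        · intro r hr y _
          have hle : maximalIdeal A ≤ (maximalIdeal A').comap α.toRingHom := by
            intro b hb
            rw [Ideal.mem_comap, ← CoefficientAlgebra.residueMap_eq_zero_iff]
            exact (CoefficientAlgebra.residueMap_comp α b).trans
              ((CoefficientAlgebra.residueMap_eq_zero_iff A b).mpr hb)
          have hr' : algebraMap A A' r ∈ maximalIdeal A' ^ n :=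
            Ideal.le_comap_pow _ n (Ideal.pow_right_mono hle n hr)
          rw [TensorProduct.tmul_smul, ← IsScalarTower.algebraMap_smul A' r]
          exact Submodule.smul_mem_smul hr' trivial
        · intro y z hy hz
          rw [TensorProduct.tmul_add]
          exact add_mem hy hz
    φ := (TensorProduct.AlgebraTensorModule.cancelBaseChange A A' (ResidueField W)
      (ResidueField W) L.M).trans L.φ
    equivariant := by
      intro g x
      rw [LinearEquiv.trans_apply, LinearEquiv.trans_apply, ← L.equivariant]
      congr 1
      induction x with
      | zero => simp
      | add x y hx hy => simp only [map_add, hx, hy]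
      | tmul c y =>
        induction y with
        | zero => simp
        | add y z hy hz => simp only [TensorProduct.tmul_add, map_add, hy, hz]
        | tmul a m => rfl }

end Lift

/-- `Def_V(A)`: the set of deformations of `V` over `A`, i.e. of isomorphism classes of lifts. -/
def Deformations (ρ : Representation (ResidueField W) Γ V) (A : CoefficientAlgebra W) :
    Type (max (u + 1) v w) :=
  Quotient (Lift.setoid ρ A)

/-- For a lift `U` over `R`, the map `f_A : Hom(R, A) → Def_V(A)`, `α ↦ Def_V(α)([U])`. -/
noncomputable def Lift.toDeformations [IsTopologicalGroup Γ]
    {ρ : Representation (ResidueField W) Γ V} {R : CoefficientAlgebra W} (U : Lift ρ R)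
    (A : CoefficientAlgebra W) (α : R →ₐ[W] A) : Deformations ρ A :=
  Quotient.mk (Lift.setoid ρ A) (U.baseChange α)

/-- `R` is a versal deformation ring of `V`: there is a lift of `V` over `R` for which the maps
`f_A` are surjective for all `A` in `Ĉ_W`, and bijective for `A = k[ε]`. -/
def IsVersalDeformationRing [IsTopologicalGroup Γ] (ρ : Representation (ResidueField W) Γ V)
    (R : CoefficientAlgebra W) : Prop :=
  ∃ U : Lift ρ R, (∀ A : CoefficientAlgebra W, Function.Surjective (U.toDeformations A)) ∧
    Function.Bijective (U.toDeformations (CoefficientAlgebra.dualNumber W))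

end Deformations

/-- The `p`-finiteness condition: every open subgroup of finite index of `Γ` has only finitely
many continuous homomorphisms to `ℤ/p`. -/
def IsPFinite (p : ℕ) (Γ : Type*) [Group Γ] [TopologicalSpace Γ] : Prop :=
  ∀ J : Subgroup Γ, IsOpen (J : Set Γ) → J.FiniteIndex →
    Finite (J →ₜ* Multiplicative (ZMod p))

section BaseChange

variable {W : Type u} [CommRing W] [IsLocalRing W] (W' : Type u) [CommRing W'] [IsLocalRing W']
  [Algebra W W'] [IsLocalHom (algebraMap W W')]

/-- The homomorphism `W' ⊗_W R → k'`, `w' ⊗ r ↦ (w' mod 𝔪_{W'}) (r mod 𝔪_R)`. -/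
noncomputable def tensorResidueMap (R : CoefficientAlgebra W) :
    W' ⊗[W] R →ₐ[W'] ResidueField W' :=
  Algebra.TensorProduct.lift (Algebra.ofId W' (ResidueField W'))
    ((IsScalarTower.toAlgHom W (ResidueField W) (ResidueField W')).comp R.residueMap)
    fun _ _ => Commute.all _ _

/-- The maximal ideal of `W' ⊗_W R` that is the kernel of the homomorphism to `k'`. -/
noncomputable def tensorMaximalIdeal (R : CoefficientAlgebra W) : Ideal (W' ⊗[W] R) :=
  RingHom.ker (tensorResidueMap W' R)

/-- The completion of `W' ⊗_W R` at this maximal ideal. It is a `W'`-algebra. -/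
abbrev CompletedTensorProduct (R : CoefficientAlgebra W) : Type u :=
  AdicCompletion (tensorMaximalIdeal W' R) (W' ⊗[W] R)

end BaseChange

/-! In bases, lifts of `V` over `A` become homomorphisms from `Γ` to matrices over `A` reducing to a
fixed representation `θ` over `k`, and deformations become their classes under conjugation by
matrices that reduce to `1` (`isVersalDeformationRing_iff`). Let `τ` be a versal lift over `R`, let
`C` be the completion of `W' ⊗ R`, and push `τ` forward to `C`; this lift is versal over `W'`.

Surjectivity. By the universal property of `C`, a lift `τ'` over `A'` in `Ĉ_{W'}` has to be reached
from a map `R → A'` over `W`. Since `A'` has residue field `k'`, versality of `R` does not apply to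
it, so `τ'` is first descended to a subring `A` of `A'` in `Ĉ_W` (`IsFramedLift.exists_descent`).
The kernel of `θ` has `p`-group images in the congruence quotients, so `p`-finiteness and a Frattini
argument show that finitely many elements topologically generate the image of `τ'`. Their entries,
corrected by constants from `W`, lie in the image `A` of a completed polynomial ring over `W`.
Chevalley's theorem shows that `A` is closed in `A'` and that continuity over `A'` implies
continuity over `A`; so all entries of `τ'` lie in `A`, and versality of `R` applies.

Injectivity over `k'[ε]`. A map `C → k'[ε]` is determined by a derivation `R → k'`. Composing with
the `k`-linear functionals `k' → k`, which separate points, reduces the claim to injectivity over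
`k[ε]`, because conjugacy over dual numbers is a linear condition.

Conversely, versal rings are unique up to isomorphism: the comparison maps compose to endomorphisms
acting trivially on tangent spaces, and these are bijective (`bijective_of_comp_eq`). Finally, `C`
belongs to `Ĉ_{W'}` although `W' ⊗ R` need not be Noetherian, because the ideal at which one
completes is finitely generated (`tensorMaximalIdeal_fg`). -/

/-! ### Homomorphisms out of adic completions. -/

namespace AdicCompletion

variable {P : Type*} [CommRing P] {I : Ideal P} {S : Type*} [CommRing S] {J : Ideal S}

/-- A ring homomorphism `P → S` that maps `I` into `J` extends to the `I`-adic completion of `P`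
if `S` is `J`-adically complete. -/
theorem exists_ringHom_extending [IsAdicComplete J S] (θ : P →+* S) (h : I ≤ J.comap θ) :
    ∃ ψ : AdicCompletion I P →+* S, ∀ x, ψ (algebraMap P _ x) = θ x := by
  have hn : ∀ n, I ^ n ≤ (J ^ n).comap θ := fun n =>
    (Ideal.pow_right_mono h n).trans (Ideal.le_comap_pow _ n)
  let f : (n : ℕ) → AdicCompletion I P →+* S ⧸ J ^ n := fun n =>
    (Ideal.quotientMap (J ^ n) θ (hn n)).comp (evalₐ I n : AdicCompletion I P →+* P ⧸ I ^ n)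
  have hf : ∀ {m n : ℕ} (hle : m ≤ n), (Ideal.Quotient.factorPow J hle).comp (f n) = f m := by
    intro m n hle
    ext x
    obtain ⟨x, rfl⟩ := mk_surjective I P x
    have h1 : Ideal.Quotient.mk (I ^ m) (x n) = Ideal.Quotient.mk (I ^ m) (x m) :=
      Ideal.mk_eq_mk I hle x
    rw [Ideal.Quotient.eq] at h1
    have h2 := hn m h1
    rw [Ideal.mem_comap, map_sub, ← Ideal.Quotient.eq] at h2
    simpa [f, evalₐ_mk] using h2
  refine ⟨IsAdicComplete.liftRingHom J f hf, fun x => ?_⟩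
  rw [← sub_eq_zero]
  refine IsHausdorff.haus (I := J) inferInstance _ fun n => ?_
  rw [SModEq.zero, smul_eq_mul, Ideal.mul_top, ← Ideal.Quotient.eq_zero_iff_mem, map_sub,
    IsAdicComplete.mk_liftRingHom, sub_eq_zero]
  simp [f, algebraMap_apply]

/-- Finite generation identifies the kernel of the `n`-th projection with the `n`-th power of the
extended ideal, which makes `P` dense for the adic topology of its completion. -/
theorem exists_sub_algebraMap_mem (fg : I.FG) (n : ℕ) (x : AdicCompletion I P) :
    ∃ y : P, x - algebraMap P _ y ∈ I.map (algebraMap P (AdicCompletion I P)) ^ n := by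
  obtain ⟨y, hy⟩ := Submodule.Quotient.mk_surjective _ (eval I P n x)
  refine ⟨y, ?_⟩
  rw [← Ideal.map_pow, ← Submodule.restrictScalars_mem P, ← Ideal.smul_top_eq_map,
    pow_smul_top_eq_ker_eval fg, LinearMap.mem_ker, map_sub, ← hy, sub_eq_zero]
  rfl

/-- A ring homomorphism on the completion that maps `I` into `J` is determined on `P`. -/
theorem ringHom_ext_of_isHausdorff [IsHausdorff J S] (fg : I.FG) {ψ ψ' : AdicCompletion I P →+* S}
    (h : ∀ x ∈ I, ψ (algebraMap P _ x) ∈ J)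
    (h' : ∀ x, ψ (algebraMap P _ x) = ψ' (algebraMap P _ x)) : ψ = ψ' := by
  have h1 : I.map (algebraMap P (AdicCompletion I P)) ≤ J.comap ψ := Ideal.map_le_iff_le_comap.2 h
  have h2 : I.map (algebraMap P (AdicCompletion I P)) ≤ J.comap ψ' :=
    Ideal.map_le_iff_le_comap.2 fun x hx => by
      rw [Ideal.mem_comap, Ideal.mem_comap, ← h']; exact h x hx
  ext x
  rw [← sub_eq_zero]
  refine IsHausdorff.haus (I := J) inferInstance _ fun n => ?_
  rw [SModEq.zero, smul_eq_mul, Ideal.mul_top]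
  obtain ⟨y, hy⟩ := exists_sub_algebraMap_mem fg n x
  have e : ψ x - ψ' x = ψ (x - algebraMap P _ y) - ψ' (x - algebraMap P _ y) := by
    rw [map_sub, map_sub, h']; abel
  rw [e]
  exact sub_mem ((Ideal.pow_right_mono h1 n).trans (Ideal.le_comap_pow _ n) hy)
    ((Ideal.pow_right_mono h2 n).trans (Ideal.le_comap_pow _ n) hy)

end AdicCompletion

/-! ### Recognising objects of `Ĉ_W`. -/

/-- A ring that is complete for a finitely generated ideal `J` is Noetherian if `S ⧸ J` is a
quotient of a Noetherian ring `Λ` over which `S` is an algebra. -/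
theorem isNoetherianRing_of_isAdicComplete {Λ S : Type*} [CommRing Λ] [IsNoetherianRing Λ]
    [CommRing S] [Algebra Λ S] (J : Ideal S) [IsAdicComplete J S] (fg : J.FG)
    (h : Function.Surjective ((Ideal.Quotient.mk J).comp (algebraMap Λ S))) :
    IsNoetherianRing S := by
  obtain ⟨n, s, hs⟩ := Submodule.fg_iff_exists_fin_generating_family.1 fg
  have hle : MvPolynomial.idealOfVars (Fin n) Λ ≤
      J.comap (MvPolynomial.aeval s : MvPolynomial (Fin n) Λ →ₐ[Λ] S).toRingHom := by
    rw [MvPolynomial.idealOfVars, Ideal.span_le]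
    rintro _ ⟨i, rfl⟩
    have : s i ∈ J := hs ▸ Submodule.subset_span ⟨i, rfl⟩
    simpa using this
  obtain ⟨ψ, hψ⟩ := AdicCompletion.exists_ringHom_extending _ hle
  -- Power series are the completion of polynomials at the variables, so the variables may be sent
  -- to generators of `J`. As they then generate `J`, surjectivity can be tested modulo `J`.
  let f : MvPowerSeries (Fin n) Λ →+* S :=
    ψ.comp (MvPowerSeries.toAdicCompletionAlgEquiv (Fin n) Λ).toRingEquiv.toRingHom
  have hf : ∀ q : MvPolynomial (Fin n) Λ, f q = MvPolynomial.aeval s q := by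
    intro q
    refine Eq.trans ?_ (hψ q)
    exact congrArg ψ ((MvPowerSeries.toAdicCompletionAlgEquiv (Fin n) Λ).commutes q)
  have hJ : (Ideal.span (Set.range MvPowerSeries.X)).map f = J := by
    rw [Ideal.map_span, ← Set.range_comp, ← hs]
    congr 2
    ext i
    have := hf (MvPolynomial.X i)
    rw [MvPolynomial.coe_X, MvPolynomial.aeval_X] at this
    exact this
  have : IsHausdorff ((Ideal.span (Set.range MvPowerSeries.X)).map f) S := by
    rw [hJ]; infer_instance
  refine isNoetherianRing_of_surjective _ S f
    (surjective_of_mk_map_comp_surjective (I := Ideal.span (Set.range MvPowerSeries.X)) f ?_)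
  intro y
  obtain ⟨y, rfl⟩ := Ideal.Quotient.mk_surjective y
  obtain ⟨c, hc⟩ := h (Ideal.Quotient.mk J y)
  refine ⟨((MvPolynomial.C c : MvPolynomial (Fin n) Λ) : MvPowerSeries (Fin n) Λ), ?_⟩
  rw [RingHom.comp_apply, hf, MvPolynomial.aeval_C]
  rw [RingHom.comp_apply, Ideal.Quotient.eq] at hc
  rwa [Ideal.Quotient.eq, hJ]

/-- An algebra over a Noetherian local ring `Λ` which is complete for the finitely generated
kernel of a homomorphism to the residue field of `Λ` is a coefficient algebra. -/
theorem isCoefficientAlgebra_of_isAdicComplete {Λ S : Type*} [CommRing Λ] [IsLocalRing Λ]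
    [IsNoetherianRing Λ] [CommRing S] [Algebra Λ S] (π : S →ₐ[Λ] ResidueField Λ)
    [IsAdicComplete (RingHom.ker π) S] (fg : (RingHom.ker π).FG) : IsCoefficientAlgebra Λ S := by
  have hπ : Function.Surjective π := fun y => by
    obtain ⟨x, rfl⟩ := residue_surjective y
    exact ⟨algebraMap Λ S x, π.commutes x⟩
  have hmax : (RingHom.ker π).IsMaximal := RingHom.ker_isMaximal_of_surjective _ hπ
  have hloc : IsLocalRing S := isLocalRing_of_isAdicComplete_maximal (RingHom.ker π)
  have hm : maximalIdeal S = RingHom.ker π := (IsLocalRing.eq_maximalIdeal hmax).symm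
  have hsurj : ∀ y : S, ∃ c : Λ, algebraMap Λ S c - y ∈ RingHom.ker π := fun y => by
    obtain ⟨c, hc⟩ := residue_surjective (π y)
    refine ⟨c, ?_⟩
    rw [RingHom.mem_ker, map_sub, AlgHom.commutes, ← hc]
    exact sub_self _
  have hnoeth : IsNoetherianRing S := by
    refine isNoetherianRing_of_isAdicComplete (Λ := Λ) (RingHom.ker π) fg fun y => ?_
    obtain ⟨y, rfl⟩ := Ideal.Quotient.mk_surjective y
    obtain ⟨c, hc⟩ := hsurj y
    exact ⟨c, Ideal.Quotient.eq.2 hc⟩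
  have hlh : IsLocalHom (algebraMap Λ S) := by
    constructor
    intro x hx
    have h : IsUnit (residue Λ x) := by
      have := hx.map π
      rwa [AlgHom.commutes] at this
    exact isUnit_of_map_unit (residue Λ) x h
  exact
    { isAdicComplete := by rw [hm]; infer_instance
      bijective_residue := by
        refine ⟨RingHom.injective _, fun y => ?_⟩
        obtain ⟨y, rfl⟩ := residue_surjective y
        obtain ⟨c, hc⟩ := hsurj y
        refine ⟨residue Λ c, ?_⟩
        rw [ResidueField.map_residue, ← sub_eq_zero, ← map_sub, residue_eq_zero_iff, hm]
        exact hc }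

/-- The completion of a `Λ`-algebra at the finitely generated kernel of a homomorphism to the
residue field of `Λ` is a coefficient algebra. -/
theorem isCoefficientAlgebra_adicCompletion {Λ P : Type*} [CommRing Λ] [IsLocalRing Λ]
    [IsNoetherianRing Λ] [CommRing P] [Algebra Λ P] (π : P →ₐ[Λ] ResidueField Λ)
    (fg : (RingHom.ker π).FG) :
    IsCoefficientAlgebra Λ (AdicCompletion (RingHom.ker π) P) := by
  have hle : RingHom.ker π ≤ (⊥ : Ideal (ResidueField Λ)).comap π.toRingHom := fun x hx => hx
  obtain ⟨ψ, hψ⟩ := AdicCompletion.exists_ringHom_extending _ hle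
  have hcomm : ∀ c : Λ, ψ (algebraMap Λ _ c) = algebraMap Λ (ResidueField Λ) c := fun c => by
    rw [IsScalarTower.algebraMap_apply Λ P, hψ]
    exact π.commutes c
  let ψ' : AdicCompletion (RingHom.ker π) P →ₐ[Λ] ResidueField Λ := { ψ with commutes' := hcomm }
  -- The completion is known to be complete for the extended ideal; the recognition lemma wants the
  -- kernel of the extended residue map.
  have hker : RingHom.ker ψ' = (RingHom.ker π).map (algebraMap P _) := by
    refine le_antisymm (fun x hx => ?_) (Ideal.map_le_iff_le_comap.2 fun x hx => ?_)
    · obtain ⟨y, hy⟩ := AdicCompletion.exists_sub_algebraMap_mem fg 1 x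
      rw [pow_one] at hy
      have hle' : (RingHom.ker π).map (algebraMap P _) ≤ RingHom.ker ψ :=
        Ideal.map_le_iff_le_comap.2 fun x hx => (hψ x).trans hx
      have hyk : y ∈ RingHom.ker π := by
        have h1 : ψ (x - algebraMap P _ y) = 0 := hle' hy
        rw [map_sub, hψ, show ψ x = 0 from hx, zero_sub, neg_eq_zero] at h1
        exact h1
      have := add_mem hy (Ideal.mem_map_of_mem (algebraMap P _) hyk)
      rwa [sub_add_cancel] at this
    · exact (hψ x).trans hx
  have := AdicCompletion.isAdicComplete_self (RingHom.ker π) fg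
  rw [← hker] at this
  exact isCoefficientAlgebra_of_isAdicComplete ψ' (hker ▸ fg.map _)

/-- Completion preserves surjections, so every element of the completion of `N` comes from that of
`M`, hence from `M`. -/
theorem IsPrecomplete.of_surjective {R M N : Type*} [CommRing R] {I : Ideal R} [AddCommGroup M]
    [Module R M] [AddCommGroup N] [Module R N] [IsPrecomplete I M] {f : M →ₗ[R] N}
    (hf : Function.Surjective f) : IsPrecomplete I N := by
  rw [← AdicCompletion.of_surjective_iff]
  intro y
  obtain ⟨x, rfl⟩ := AdicCompletion.map_surjective I hf y
  obtain ⟨x, rfl⟩ := AdicCompletion.of_surjective I M x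
  exact ⟨f x, by rw [AdicCompletion.map_of]⟩

namespace IsCoefficientAlgebra

variable {W : Type*} [CommRing W] [IsLocalRing W] {A : Type*} [CommRing A] [Algebra W A]

/-- A nontrivial quotient of a coefficient algebra is a coefficient algebra. -/
theorem quotient [IsCoefficientAlgebra W A] (K : Ideal A) (hK : K ≠ ⊤) :
    IsCoefficientAlgebra W (A ⧸ K) := by
  have : Nontrivial (A ⧸ K) := Ideal.Quotient.nontrivial_iff.2 hK
  have hloc : IsLocalRing (A ⧸ K) :=
    IsLocalRing.of_surjective' (Ideal.Quotient.mk K) Ideal.Quotient.mk_surjective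
  have hlh : IsLocalHom (Ideal.Quotient.mk K) :=
    Ideal.Quotient.mk_surjective.isLocalHom _
  have hm : maximalIdeal (A ⧸ K) = (maximalIdeal A).map (algebraMap A (A ⧸ K)) :=
    ((IsLocalRing.map_maximalIdeal_of_surjective _ Ideal.Quotient.mk_surjective)).symm
  have hWA : IsLocalHom (algebraMap W (A ⧸ K)) := by
    rw [IsScalarTower.algebraMap_eq W A]
    exact RingHom.isLocalHom_comp (Ideal.Quotient.mk K) (algebraMap W A)
  have := isAdicComplete (W := W) (A := A)
  exact
    { isAdicComplete := by
        have h1 : IsPrecomplete (maximalIdeal A) (A ⧸ K) :=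
          .of_surjective (f := Submodule.mkQ K) (Submodule.mkQ_surjective K)
        rw [hm, IsAdicComplete.map_algebraMap_iff]
        exact {}
      bijective_residue := by
        refine ⟨RingHom.injective _, fun y => ?_⟩
        obtain ⟨y, rfl⟩ := residue_surjective y
        obtain ⟨y, rfl⟩ := Ideal.Quotient.mk_surjective y
        obtain ⟨z, hz⟩ := (bijective_residue (W := W) (A := A)).2 (residue A y)
        obtain ⟨c, rfl⟩ := residue_surjective z
        refine ⟨residue W c, ?_⟩
        rw [ResidueField.map_residue, ← sub_eq_zero, ← map_sub, residue_eq_zero_iff] at hz ⊢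
        rw [hm]
        exact Ideal.mem_map_of_mem (algebraMap A (A ⧸ K)) hz }

end IsCoefficientAlgebra

/-! ### Chevalley's theorem and closed subrings. -/

theorem isArtinianRing_quotient_maximalIdeal_pow {A : Type*} [CommRing A] [IsLocalRing A]
    [IsNoetherianRing A] (n : ℕ) : IsArtinianRing (A ⧸ maximalIdeal A ^ n) := by
  rcases subsingleton_or_nontrivial (A ⧸ maximalIdeal A ^ n) with h | h
  · exact inferInstance
  have hloc := IsLocalRing.of_surjective' (Ideal.Quotient.mk (maximalIdeal A ^ n))
    Ideal.Quotient.mk_surjective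
  have hlh := IsLocalHom.of_surjective (Ideal.Quotient.mk (maximalIdeal A ^ n))
    Ideal.Quotient.mk_surjective
  refine (isArtinianRing_iff_isNilpotent_maximalIdeal _).2 ⟨n, ?_⟩
  rw [← IsLocalRing.map_maximalIdeal_of_surjective _ Ideal.Quotient.mk_surjective, ← Ideal.map_pow,
    Ideal.map_quotient_self]
  rfl

/-- Chevalley's theorem: in a complete Noetherian local ring, a descending sequence of ideals with
zero intersection is cofinal with the powers of the maximal ideal. -/
theorem exists_le_maximalIdeal_pow_of_iInf_eq_bot {A : Type*} [CommRing A] [IsLocalRing A]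
    [IsNoetherianRing A] [IsAdicComplete (maximalIdeal A) A] (b : ℕ → Ideal A) (hb : Antitone b)
    (h : ⨅ n, b n = ⊥) (k : ℕ) : ∃ n, b n ≤ maximalIdeal A ^ k := by
  set m := maximalIdeal A
  -- The images of the `b n` in the Artinian ring `A ⧸ m ^ i` stabilise, at an index `N i`.
  have hstab : ∀ i, ∃ N, ∀ n, N ≤ n → b N ⊔ m ^ i = b n ⊔ m ^ i := by
    intro i
    have hart : IsArtinianRing (A ⧸ m ^ i) := isArtinianRing_quotient_maximalIdeal_pow i
    let f : ℕ →o (Ideal (A ⧸ m ^ i))ᵒᵈ :=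
      ⟨fun n => OrderDual.toDual ((b n).map (Ideal.Quotient.mk (m ^ i))),
        fun _ _ hn => Ideal.map_mono (hb hn)⟩
    obtain ⟨N, hN⟩ := IsArtinian.monotone_stabilizes f
    refine ⟨N, fun n hn => ?_⟩
    have h1 : (b N).map (Ideal.Quotient.mk (m ^ i)) = (b n).map (Ideal.Quotient.mk (m ^ i)) :=
      hN n hn
    have h2 := congrArg (Ideal.comap (Ideal.Quotient.mk (m ^ i))) h1
    simpa [Ideal.comap_map_of_surjective' _ Ideal.Quotient.mk_surjective] using h2
  choose N hN using hstab
  by_contra! hk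
  obtain ⟨y, hy, hyk⟩ := SetLike.not_le_iff_exists.1 (hk (N k))
  -- By stability an element of the `i`-th stable image has a representative in `b` at the larger of
  -- the two indices, so it changes only by an element of `m ^ i`.
  have hstep : ∀ i x, x ∈ b (N i) ⊔ m ^ i → ∃ x' ∈ b (N (i + 1)) ⊔ m ^ (i + 1), x' - x ∈ m ^ i := by
    intro i x hx
    rw [hN i _ (le_max_left (N i) (N (i + 1)))] at hx
    obtain ⟨u, hu, v, hv, rfl⟩ := Submodule.mem_sup.1 hx
    refine ⟨u, Ideal.mem_sup_left (hb (le_max_right _ _) hu), ?_⟩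
    rw [sub_add_cancel_left]
    exact neg_mem hv
  choose! g hg hg' using hstep
  -- The index is shifted by `k` so that every correction lies in `m ^ k`; if the limit is `0`, then
  -- `y ∈ m ^ k`, a contradiction.
  let x : ℕ → A := fun i => Nat.rec y (fun i x => g (k + i) x) i
  have hx : ∀ i, x i ∈ b (N (k + i)) ⊔ m ^ (k + i) := by
    intro i
    induction i with
    | zero => exact Ideal.mem_sup_left hy
    | succ i ih => exact hg _ _ ih
  have hsucc : ∀ i, x (i + 1) - x i ∈ m ^ (k + i) := fun i => hg' _ _ (hx i)
  have hxx : ∀ i d, x (i + d) - x i ∈ m ^ (k + i) := by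
    intro i d
    induction d with
    | zero => simp
    | succ d ih =>
      have := add_mem (Ideal.pow_le_pow_right (by omega) (hsucc (i + d))) ih
      rwa [sub_add_sub_cancel] at this
  obtain ⟨L, hL⟩ := IsPrecomplete.prec (I := m) inferInstance (f := x) (by
    intro i n hin
    obtain ⟨d, rfl⟩ := Nat.exists_eq_add_of_le hin
    rw [SModEq.comm, SModEq.sub_mem, smul_eq_mul, Ideal.mul_top]
    exact Ideal.pow_le_pow_right (by omega) (hxx i d))
  simp only [SModEq.sub_mem, smul_eq_mul, Ideal.mul_top] at hL
  have hL0 : L = 0 := by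
    rw [← Ideal.mem_bot, ← h, Ideal.mem_iInf]
    intro n
    rw [← Ideal.Quotient.eq_zero_iff_mem]
    -- Krull's intersection theorem: `b n` is closed, so it contains the limit.
    refine IsHausdorff.haus (I := m) (M := A ⧸ b n) inferInstance _ fun i => ?_
    rw [SModEq.zero]
    have h1 : L ∈ b n ⊔ m ^ i := by
      have h2 := hx i
      rw [hN _ _ (le_max_right n _)] at h2
      have h3 : x i ∈ b n ⊔ m ^ i :=
        sup_le_sup (hb (le_max_left _ _)) (Ideal.pow_le_pow_right (by omega)) h2
      have h4 := sub_mem h3 (Ideal.mem_sup_right (hL i))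
      rwa [sub_sub_cancel] at h4
    obtain ⟨u, hu, v, hv, rfl⟩ := Submodule.mem_sup.1 h1
    rw [map_add, Ideal.Quotient.eq_zero_iff_mem.2 hu, zero_add]
    have : Ideal.Quotient.mk (b n) v = v • (1 : A ⧸ b n) := by
      rw [Algebra.smul_def, mul_one]; rfl
    rw [this]
    exact Submodule.smul_mem_smul hv trivial
  apply hyk
  have h1 : x k - x 0 ∈ m ^ k := by simpa using hxx 0 k
  have h2 := hL k
  rw [hL0, sub_zero] at h2
  have := sub_mem h2 h1
  rwa [sub_sub_cancel] at this

section Closed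

variable {A A' : Type*} [CommRing A] [IsLocalRing A] [IsNoetherianRing A]
  [IsAdicComplete (maximalIdeal A) A] [CommRing A'] [IsLocalRing A'] [IsNoetherianRing A']

/-- The contracted ideals intersect in zero, by Krull in `A'` and injectivity of `j`, so Chevalley
applies. Thus the topology induced from `A'` is at least as fine as that of `A`. -/
theorem exists_comap_maximalIdeal_pow_le (j : A →+* A') (hj : Function.Injective j) (k : ℕ) :
    ∃ n, (maximalIdeal A' ^ n).comap j ≤ maximalIdeal A ^ k := by
  refine exists_le_maximalIdeal_pow_of_iInf_eq_bot _
    (fun _ _ hn => Ideal.comap_mono (Ideal.pow_le_pow_right hn)) ?_ k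
  rw [eq_bot_iff]
  intro a ha
  rw [Ideal.mem_bot, ← map_eq_zero_iff j hj]
  refine IsHausdorff.haus (I := maximalIdeal A') inferInstance _ fun n => ?_
  rw [SModEq.zero, smul_eq_mul, Ideal.mul_top]
  exact (Ideal.mem_iInf.1 ha) n

/-- A complete Noetherian local subring, dominated by a Noetherian local ring, is closed in it. -/
theorem mem_range_of_forall_exists_sub_mem (j : A →+* A') (hj : Function.Injective j)
    (hm : maximalIdeal A ≤ (maximalIdeal A').comap j) {x : A'}
    (h : ∀ n, ∃ a, x - j a ∈ maximalIdeal A' ^ n) : x ∈ j.range := by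
  choose a ha using h
  choose φ hφ using exists_comap_maximalIdeal_pow_le j hj
  -- Dominating `φ k` makes the approximants Cauchy in `A`, dominating `k` makes their images
  -- converge to `x`, and monotonicity compares two stages.
  let Φ : ℕ → ℕ := fun k => k + ∑ i ∈ Finset.range (k + 1), φ i
  have hΦ : Monotone Φ := fun k l hkl => add_le_add hkl
    (Finset.sum_le_sum_of_subset (Finset.range_mono (by omega)))
  have hφΦ : ∀ k, φ k ≤ Φ k := fun k =>
    (Finset.single_le_sum (f := φ) (fun _ _ => Nat.zero_le _)
      (Finset.mem_range.2 (Nat.lt_succ_self k))).trans (Nat.le_add_left _ _)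
  obtain ⟨L, hL⟩ := IsPrecomplete.prec (I := maximalIdeal A) inferInstance
    (f := fun k => a (Φ k)) (by
      intro k l hkl
      rw [SModEq.sub_mem, smul_eq_mul, Ideal.mul_top]
      refine hφ k (Ideal.pow_le_pow_right (hφΦ k) ?_)
      have h1 := ha (Φ k)
      have h2 := Ideal.pow_le_pow_right (hΦ hkl) (ha (Φ l))
      have h3 := sub_mem h2 h1
      rwa [sub_sub_sub_cancel_left, ← map_sub] at h3)
  simp only [SModEq.sub_mem, smul_eq_mul, Ideal.mul_top] at hL
  refine ⟨L, ?_⟩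
  rw [← sub_eq_zero]
  refine IsHausdorff.haus (I := maximalIdeal A') inferInstance _ fun k => ?_
  rw [SModEq.zero, smul_eq_mul, Ideal.mul_top]
  have h1 : j (a (Φ k) - L) ∈ maximalIdeal A' ^ k :=
    (Ideal.pow_right_mono hm k).trans (Ideal.le_comap_pow _ k) (hL k)
  have h2 := Ideal.pow_le_pow_right (Nat.le_add_right k _) (ha (Φ k))
  have h3 := neg_mem (add_mem h1 h2)
  rw [map_sub] at h3
  convert h3 using 1
  ring

end Closed

theorem maximalIdeal_adicCompletion {P : Type*} [CommRing P] (I : Ideal P) [I.IsMaximal]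
    (fg : I.FG) [IsLocalRing (AdicCompletion I P)] :
    maximalIdeal (AdicCompletion I P) = I.map (algebraMap P (AdicCompletion I P)) :=
  (IsLocalRing.eq_maximalIdeal (AdicCompletion.isMaximal_map_of_le I I le_rfl fg)).symm

/-! ### Residue maps, dual numbers and derivations. -/

namespace CoefficientAlgebra

variable {W : Type u} [CommRing W] [IsLocalRing W]

instance (A : CoefficientAlgebra W) : IsAdicComplete (maximalIdeal A) A :=
  IsCoefficientAlgebra.isAdicComplete (W := W)

/-- The kernel must be the maximal ideal, and modulo it every element is a constant from `W`, where
both maps agree. -/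
theorem algHom_residueField_apply {A : CoefficientAlgebra W} (f : A →ₐ[W] ResidueField W) (a : A) :
    f a = A.residueMap a := by
  obtain ⟨x, hx⟩ := residue_surjective (A.residueMap a)
  have hm : a - algebraMap W A x ∈ maximalIdeal A := by
    rw [← residueMap_eq_zero_iff, map_sub, AlgHom.commutes, sub_eq_zero, ← hx]; rfl
  have hker : RingHom.ker f = maximalIdeal A := by
    apply IsLocalRing.eq_maximalIdeal
    apply RingHom.ker_isMaximal_of_surjective
    intro y
    obtain ⟨z, rfl⟩ := residue_surjective y
    exact ⟨algebraMap W A z, AlgHom.commutes _ z⟩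
  have h : f (a - algebraMap W A x) = 0 := by
    rw [← RingHom.mem_ker, hker]; exact hm
  rw [map_sub, AlgHom.commutes, sub_eq_zero] at h
  exact h.trans hx

theorem exists_sub_algebraMap_mem (A : CoefficientAlgebra W) (a : A) :
    ∃ w : W, a - algebraMap W A w ∈ maximalIdeal A := by
  obtain ⟨x, hx⟩ := residue_surjective (A.residueMap a)
  refine ⟨x, ?_⟩
  rw [← residueMap_eq_zero_iff, map_sub, AlgHom.commutes, sub_eq_zero, ← hx]; rfl

theorem map_mem_maximalIdeal {A B : CoefficientAlgebra W} (α : A →ₐ[W] B) {a : A}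
    (ha : a ∈ maximalIdeal A) : α a ∈ maximalIdeal B := by
  rwa [← residueMap_eq_zero_iff, residueMap_comp, residueMap_eq_zero_iff]

theorem map_mem_maximalIdeal_pow {A B : CoefficientAlgebra W} (α : A →ₐ[W] B) {n : ℕ} {a : A}
    (ha : a ∈ maximalIdeal A ^ n) : α a ∈ maximalIdeal B ^ n := by
  have h : maximalIdeal A ≤ (maximalIdeal B).comap α.toRingHom :=
    fun _ h => map_mem_maximalIdeal α h
  exact (Ideal.pow_right_mono h n).trans (Ideal.le_comap_pow _ n) ha

theorem residueMap_dualNumber (x : dualNumber W) :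
    (dualNumber W).residueMap x = TrivSqZeroExt.fst (R := ResidueField W) (M := ResidueField W) x :=
  (algHom_residueField_apply (A := dualNumber W) ((TrivSqZeroExt.fstHom (ResidueField W)
    (ResidueField W) (ResidueField W)).restrictScalars W) x).symm

/-- The `ε`-coefficient of an element of `k[ε]`. -/
noncomputable def epsCoeff : dualNumber W →+ ResidueField W :=
  (TrivSqZeroExt.sndHom (ResidueField W) (ResidueField W)).toAddMonoidHom

theorem dualNumber_ext {x y : dualNumber W}
    (h : (dualNumber W).residueMap x = (dualNumber W).residueMap y)
    (h' : epsCoeff x = epsCoeff y) : x = y := by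
  rw [residueMap_dualNumber, residueMap_dualNumber] at h
  exact TrivSqZeroExt.ext h h'

theorem epsCoeff_mul (x y : dualNumber W) : epsCoeff (x * y) =
    (dualNumber W).residueMap x * epsCoeff y + (dualNumber W).residueMap y * epsCoeff x := by
  rw [residueMap_dualNumber, residueMap_dualNumber]
  rw [mul_comm (TrivSqZeroExt.fst y)]
  exact TrivSqZeroExt.snd_mul (R := ResidueField W) (M := ResidueField W) x y

theorem epsCoeff_algebraMap (w : W) : epsCoeff (algebraMap W (dualNumber W) w) = 0 := rfl

/-- The homomorphism `A → k[ε]` given by a `W`-linear derivation `A → k`. -/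
noncomputable def dualNumberHom (A : CoefficientAlgebra W) (D : A →+ ResidueField W)
    (hmul : ∀ a b, D (a * b) = A.residueMap a * D b + A.residueMap b * D a)
    (hW : ∀ w, D (algebraMap W A w) = 0) : A →ₐ[W] dualNumber W :=
  letI f : A →ₐ[W] DualNumber (ResidueField W) :=
    { toFun := fun a => (A.residueMap a, D a)
      map_one' := TrivSqZeroExt.ext (map_one A.residueMap) (by
        have := hW 1
        rw [map_one] at this
        exact this)
      map_zero' := TrivSqZeroExt.ext (map_zero A.residueMap) (map_zero D)
      map_add' := fun a b => TrivSqZeroExt.ext (map_add A.residueMap a b) (map_add D a b)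
      map_mul' := fun a b => TrivSqZeroExt.ext (map_mul A.residueMap a b)
        ((hmul a b).trans (congrArg _ (mul_comm _ _)))
      commutes' := fun w => TrivSqZeroExt.ext (A.residueMap.commutes w) (hW w) }
  f

end CoefficientAlgebra

open CoefficientAlgebra

/-! ### Passing between `Ĉ_W` and `Ĉ_{W'}`. -/

section ChangeOfCoefficients

variable {W : Type u} [CommRing W] [IsLocalRing W] {W' : Type u} [CommRing W']
  [IsLocalRing W'] [Algebra W W'] [IsLocalHom (algebraMap W W')]

/-- Both sides agree on constants from `W`, and these represent all of `A` modulo its maximal ideal.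
-/
theorem residueMap_map_eq {A : CoefficientAlgebra W} {A' : CoefficientAlgebra W'} (j : A →+* A')
    (hj : ∀ w, j (algebraMap W A w) = algebraMap W' A' (algebraMap W W' w))
    (hm : maximalIdeal A ≤ (maximalIdeal A').comap j) (a : A) :
    A'.residueMap (j a) = algebraMap (ResidueField W) (ResidueField W') (A.residueMap a) := by
  obtain ⟨w, hw⟩ := A.exists_sub_algebraMap_mem a
  have h1 := hm hw
  rw [Ideal.mem_comap, ← residueMap_eq_zero_iff, map_sub, map_sub, hj, AlgHom.commutes,
    sub_eq_zero] at h1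
  rw [← residueMap_eq_zero_iff, map_sub, AlgHom.commutes, sub_eq_zero] at hw
  rw [h1, hw]
  rfl

/-- Finitely many elements of the maximal ideal of an object of `Ĉ_{W'}` lie in a subring that is
an object of `Ĉ_W`. -/
theorem exists_coefficientAlgebra_subring [IsNoetherianRing W] (A' : CoefficientAlgebra W')
    {σ : Type} [Finite σ] (e : σ → A') (he : ∀ i, e i ∈ maximalIdeal A') :
    ∃ (A : CoefficientAlgebra W) (j : A →+* A'), Function.Injective j ∧
      (∀ w, j (algebraMap W A w) = algebraMap W' A' (algebraMap W W' w)) ∧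
      maximalIdeal A ≤ (maximalIdeal A').comap j ∧ ∀ i, e i ∈ j.range := by
  -- The kernel of `π` is the ideal generated by the variables and the maximal ideal of `W`; `θ`
  -- carries it into the maximal ideal of `A'` and so extends to the completion.
  let π : MvPolynomial σ W →ₐ[W] ResidueField W := MvPolynomial.aeval fun _ => 0
  let θ : MvPolynomial σ W →+* A' :=
    MvPolynomial.eval₂Hom ((algebraMap W' A').comp (algebraMap W W')) e
  have hres : A'.residueMap.toRingHom.comp θ =
      (algebraMap (ResidueField W) (ResidueField W')).comp π.toRingHom := by
    refine MvPolynomial.ringHom_ext (fun w => ?_) fun i => ?_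
    · simp only [RingHom.comp_apply, θ, π, MvPolynomial.coe_eval₂Hom, MvPolynomial.eval₂_C]
      refine (A'.residueMap.commutes _).trans ?_
      refine Eq.trans ?_ (congrArg _ (MvPolynomial.aeval_C _ w).symm)
      rfl
    · simp only [RingHom.comp_apply, θ, π, MvPolynomial.coe_eval₂Hom, MvPolynomial.eval₂_X]
      refine ((A'.residueMap_eq_zero_iff _).2 (he i)).trans ?_
      refine Eq.trans ?_ (congrArg _ (MvPolynomial.aeval_X _ i).symm)
      rw [map_zero]
  have hle : RingHom.ker π ≤ (maximalIdeal A').comap θ := fun x hx => by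
    rw [Ideal.mem_comap, ← residueMap_eq_zero_iff]
    refine (congrArg (fun f : _ →+* _ => f x) hres).trans ?_
    exact (congrArg _ hx).trans (map_zero _)
  have fg : (RingHom.ker π).FG := Ideal.fg_of_isNoetherianRing _
  obtain ⟨ψ, hψ⟩ := AdicCompletion.exists_ringHom_extending θ hle
  have hB := isCoefficientAlgebra_adicCompletion π fg
  have hmax : (RingHom.ker π).IsMaximal := RingHom.ker_isMaximal_of_surjective _ fun y => by
    obtain ⟨x, rfl⟩ := residue_surjective y
    exact ⟨algebraMap W _ x, π.commutes x⟩
  have hloc := hB.toIsLocalRing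
  have hmB := maximalIdeal_adicCompletion (RingHom.ker π) fg
  -- The image of `ψ`, taken as a quotient so that it inherits completeness and residue field `k`.
  have hA := IsCoefficientAlgebra.quotient (W := W) (RingHom.ker ψ) (RingHom.ker_ne_top ψ)
  refine ⟨⟨_ ⧸ RingHom.ker ψ⟩, RingHom.kerLift ψ, RingHom.kerLift_injective ψ, fun w => ?_, ?_, ?_⟩
  · refine (hψ (MvPolynomial.C w)).trans ?_
    simp [θ]
  · intro a ha
    obtain ⟨x, rfl⟩ := Ideal.Quotient.mk_surjective a
    have hx : x ∈ maximalIdeal (AdicCompletion (RingHom.ker π) (MvPolynomial σ W)) := fun hu =>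
      ha (hu.map (Ideal.Quotient.mk (RingHom.ker ψ)))
    rw [hmB] at hx
    have h1 : (RingHom.ker π).map (algebraMap _ (AdicCompletion (RingHom.ker π) _)) ≤
        (maximalIdeal A').comap ψ := Ideal.map_le_iff_le_comap.2 fun x hx => by
      rw [Ideal.mem_comap, Ideal.mem_comap, hψ]
      exact hle hx
    exact h1 hx
  · intro i
    refine ⟨Ideal.Quotient.mk _ (algebraMap (MvPolynomial σ W) _ (MvPolynomial.X i)), ?_⟩
    refine (hψ (MvPolynomial.X i)).trans ?_
    simp [θ]

/-- The ideal is generated by the maximal ideals of `W'` and `R`: modulo these every tensor is a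
constant from `W'`, and a constant in the kernel lies in the maximal ideal of `W'`. -/
theorem tensorMaximalIdeal_fg [IsNoetherianRing W'] (R : CoefficientAlgebra W) :
    (tensorMaximalIdeal W' R).FG := by
  let J : Ideal (W' ⊗[W] R) :=
    (maximalIdeal W').map (algebraMap W' (W' ⊗[W] R)) ⊔
      (maximalIdeal R).map (Algebra.TensorProduct.includeRight : R →ₐ[W] W' ⊗[W] R).toRingHom
  have hJ : J.FG := Submodule.FG.sup (Ideal.FG.map (Ideal.fg_of_isNoetherianRing _) _)
    (Ideal.FG.map (Ideal.fg_of_isNoetherianRing _) _)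
  have hle : J ≤ tensorMaximalIdeal W' R := by
    refine sup_le (Ideal.map_le_iff_le_comap.2 fun x hx => ?_)
      (Ideal.map_le_iff_le_comap.2 fun x hx => ?_)
    · refine ((tensorResidueMap W' R).commutes x).trans ?_
      exact (residue_eq_zero_iff x).2 hx
    · change tensorResidueMap W' R (1 ⊗ₜ x) = 0
      have : R.residueMap x = 0 := (R.residueMap_eq_zero_iff x).2 hx
      simp [tensorResidueMap, this]
  have hred : ∀ x : W' ⊗[W] R, ∃ w : W', x - algebraMap W' _ w ∈ J := by
    intro x
    induction x with
    | zero => exact ⟨0, by simp⟩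
    | add x y hx hy =>
      obtain ⟨a, ha⟩ := hx
      obtain ⟨b, hb⟩ := hy
      refine ⟨a + b, ?_⟩
      rw [map_add, add_sub_add_comm]
      exact add_mem ha hb
    | tmul a r =>
      obtain ⟨w, hw⟩ := R.exists_sub_algebraMap_mem r
      refine ⟨a * algebraMap W W' w, ?_⟩
      have e : a ⊗ₜ[W] r - algebraMap W' (W' ⊗[W] R) (a * algebraMap W W' w) =
          algebraMap W' (W' ⊗[W] R) a *
            (Algebra.TensorProduct.includeRight : R →ₐ[W] W' ⊗[W] R)
              (r - algebraMap W R w) := by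
        rw [Algebra.TensorProduct.algebraMap_apply, Algebra.TensorProduct.algebraMap_apply,
          Algebra.TensorProduct.includeRight_apply, Algebra.TensorProduct.tmul_mul_tmul,
          Algebra.algebraMap_self_apply, Algebra.algebraMap_self_apply, mul_one, one_mul,
          TensorProduct.tmul_sub, Algebra.algebraMap_eq_smul_one (A := R) w, TensorProduct.tmul_smul,
          mul_comm a, ← Algebra.smul_def, TensorProduct.smul_tmul']
      rw [e]
      exact J.mul_mem_left _ (Ideal.mem_sup_right (Ideal.mem_map_of_mem _ hw))
  have : tensorMaximalIdeal W' R = J := by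
    refine le_antisymm (fun x hx => ?_) hle
    obtain ⟨w, hw⟩ := hred x
    have h1 := hle hw
    have h2 : tensorResidueMap W' R (x - algebraMap W' _ w) = 0 := h1
    rw [map_sub, show tensorResidueMap W' R x = 0 from hx, AlgHom.commutes, zero_sub,
      neg_eq_zero] at h2
    have h3 : w ∈ maximalIdeal W' := (residue_eq_zero_iff w).1 h2
    have h4 := add_mem hw (Ideal.mem_sup_left (Ideal.mem_map_of_mem (algebraMap W' _) h3))
    rwa [sub_add_cancel] at h4
  rw [this]
  exact hJ

end ChangeOfCoefficients

/-! ### Topological generation from `p`-finiteness. -/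

/-- A maximal subgroup above `D` is normal, since finite `p`-groups are nilpotent. An element of
order `p` in the quotient generates it by maximality, so the quotient is cyclic of order `p`. -/
theorem IsPGroup.exists_hom_zmod {p : ℕ} [Fact p.Prime] {G : Type*} [Group G] [Finite G]
    (hG : IsPGroup p G) {D : Subgroup G} (hD : D ≠ ⊤) :
    ∃ f : G →* Multiplicative (ZMod p), D ≤ f.ker ∧ f ≠ 1 := by
  obtain ⟨C, hC, hDC⟩ := (eq_top_or_exists_le_coatom D).resolve_left hD
  have hnil := hG.isNilpotent
  have hnorm : C.Normal :=
    Subgroup.NormalizerCondition.normal_of_coatom C Group.normalizerCondition_of_isNilpotent hC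
  have hnt : Nontrivial (G ⧸ C) := (QuotientGroup.nontrivial_iff).2 hC.1
  have hQ : IsPGroup p (G ⧸ C) := hG.to_quotient C
  obtain ⟨n, hn, hcard⟩ := hQ.nontrivial_iff_card.1 hnt
  obtain ⟨q, hq⟩ := exists_prime_orderOf_dvd_card' (G := G ⧸ C) p
    (hcard ▸ dvd_pow_self p hn.ne')
  have hq1 : q ≠ 1 := fun h => by
    rw [h, orderOf_one] at hq
    exact (Fact.out : p.Prime).one_lt.ne hq
  have htop : (Subgroup.zpowers q).comap (QuotientGroup.mk' C) = ⊤ := by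
    refine hC.2 _ (lt_of_le_of_ne (fun x hx => ?_) fun h => hq1 ?_)
    · rw [Subgroup.mem_comap, QuotientGroup.mk'_apply, (QuotientGroup.eq_one_iff x).2 hx]
      exact one_mem _
    · obtain ⟨x, rfl⟩ := QuotientGroup.mk'_surjective C q
      have : x ∈ C := by
        rw [h]
        exact Subgroup.mem_zpowers _
      exact (QuotientGroup.eq_one_iff x).2 this
  have hz : ∀ x : G ⧸ C, x ∈ Subgroup.zpowers q := fun x => by
    obtain ⟨x, rfl⟩ := QuotientGroup.mk'_surjective C x
    have : x ∈ (Subgroup.zpowers q).comap (QuotientGroup.mk' C) := htop ▸ Subgroup.mem_top x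
    exact this
  have hp : Nat.card (G ⧸ C) = p := (orderOf_eq_card_of_forall_mem_zpowers hz).symm.trans hq
  have hcyc : IsCyclic (G ⧸ C) := ⟨q, hz⟩
  have e : (G ⧸ C) ≃* Multiplicative (ZMod p) := hp ▸ (zmodCyclicMulEquiv hcyc).symm
  refine ⟨e.toMonoidHom.comp (QuotientGroup.mk' C), fun x hx => ?_, fun h => hq1 ?_⟩
  · rw [MonoidHom.mem_ker, MonoidHom.comp_apply, QuotientGroup.mk'_apply,
      (QuotientGroup.eq_one_iff x).2 (hDC hx), map_one]
  · obtain ⟨x, rfl⟩ := QuotientGroup.mk'_surjective C q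
    exact (map_eq_one_iff e e.injective).1 (DFunLike.congr_fun h x)

/-- In a compact group satisfying the `p`-finiteness condition, an open subgroup `J` has a finite
subset that, together with coset representatives, generates all finite quotients of the group in
which the image of `J` is a `p`-group. -/
theorem IsPFinite.exists_finite_closure_sup_eq_top {p : ℕ} [Fact p.Prime] {Γ : Type*} [Group Γ]
    [TopologicalSpace Γ] [IsTopologicalGroup Γ] [CompactSpace Γ] (hΓ : IsPFinite p Γ)
    (J : Subgroup Γ) (hJ : IsOpen (J : Set Γ)) :
    ∃ S : Set Γ, S.Finite ∧ ∀ N : Subgroup Γ, N.Normal → IsOpen (N : Set Γ) →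
      (∀ g ∈ J, ∃ k, g ^ p ^ k ∈ N) → Subgroup.closure S ⊔ N = ⊤ := by
  have hJfin : Finite (Γ ⧸ J) := J.quotient_finite_of_isOpen hJ
  have hfin := hΓ J hJ J.finiteIndex_of_finite_quotient
  -- One element of `J` detecting each of the finitely many nontrivial characters. This choice does
  -- not depend on `N`.
  have hsep : ∀ f : J →ₜ* Multiplicative (ZMod p), ∃ x : J, f ≠ 1 → f x ≠ 1 := by
    intro f
    by_contra! h
    exact (h 1).1 (ContinuousMonoidHom.ext fun x => (h x).2)
  choose s hs using hsep
  refine ⟨(fun x : J => (x : Γ)) '' Set.range s ∪ Set.range (Quotient.out : Γ ⧸ J → Γ),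
    ((Set.finite_range s).image _).union (Set.finite_range _), fun N hN hNo hpow => ?_⟩
  set S : Set Γ := _ ∪ _
  have hNfin : Finite (Γ ⧸ N) := N.quotient_finite_of_isOpen hNo
  have hNidx : N.FiniteIndex := N.finiteIndex_of_finite_quotient
  let N' : Subgroup J := N.subgroupOf J
  have hN'o : IsOpen (N' : Set J) := hNo.preimage continuous_subtype_val
  have hQ : IsPGroup p (J ⧸ N') := by
    intro x
    obtain ⟨x, rfl⟩ := QuotientGroup.mk'_surjective N' x
    obtain ⟨k, hk⟩ := hpow x x.2
    refine ⟨k, ?_⟩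
    rw [← map_pow]
    exact (QuotientGroup.eq_one_iff _).2 (Subgroup.mem_subgroupOf.2 (by simpa using hk))
  -- Frattini argument: if the chosen elements failed to generate the `p`-group `J ⧸ N'`, a
  -- nontrivial character would kill them all, including the one chosen to detect it.
  have htop : (Subgroup.closure (Set.range s)).map (QuotientGroup.mk' N') = ⊤ := by
    by_contra hne
    obtain ⟨f, hf, hf1⟩ := hQ.exists_hom_zmod hne
    let F : J →* Multiplicative (ZMod p) := f.comp (QuotientGroup.mk' N')
    have hFc : Continuous F := by
      refine continuous_of_continuousAt_one F ?_
      have h1 : ∀ᶠ x in nhds (1 : J), F x = 1 := by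
        filter_upwards [hN'o.mem_nhds N'.one_mem] with x hx
        change f (QuotientGroup.mk' N' x) = 1
        rw [QuotientGroup.mk'_apply, (QuotientGroup.eq_one_iff x).2 hx, map_one]
      rw [ContinuousAt, map_one]
      exact Filter.Tendsto.congr' (h1.mono fun _ h => h.symm) tendsto_const_nhds
    let F' : J →ₜ* Multiplicative (ZMod p) := ⟨F, hFc⟩
    have hF1 : F' ≠ 1 := fun h => hf1 (MonoidHom.ext fun x => by
      obtain ⟨x, rfl⟩ := QuotientGroup.mk'_surjective N' x
      exact DFunLike.congr_fun h x)
    refine hs F' hF1 (hf ⟨s F', Subgroup.subset_closure ⟨F', rfl⟩, rfl⟩)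
  have hJle : J ≤ Subgroup.closure S ⊔ N := by
    intro g hg
    have : QuotientGroup.mk' N' ⟨g, hg⟩ ∈
        (Subgroup.closure (Set.range s)).map (QuotientGroup.mk' N') := htop ▸ Subgroup.mem_top _
    obtain ⟨h, hh, hhg⟩ := this
    have h1 : h⁻¹ * ⟨g, hg⟩ ∈ N' := QuotientGroup.eq.1 hhg
    have h2 : (h : Γ)⁻¹ * g ∈ N := Subgroup.mem_subgroupOf.1 h1
    have h3 : (h : Γ) ∈ Subgroup.closure S := by
      have h4 : (h : Γ) ∈ (Subgroup.closure (Set.range s)).map J.subtype := ⟨h, hh, rfl⟩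
      rw [MonoidHom.map_closure] at h4
      exact Subgroup.closure_mono Set.subset_union_left h4
    rw [← mul_inv_cancel_left (h : Γ) g]
    exact mul_mem (Subgroup.mem_sup_left h3) (Subgroup.mem_sup_right h2)
  refine eq_top_iff.2 fun g _ => ?_
  have h1 : (Quotient.out (g : Γ ⧸ J))⁻¹ * g ∈ J :=
    QuotientGroup.eq.1 (Quotient.out_eq (g : Γ ⧸ J))
  rw [← mul_inv_cancel_left (Quotient.out (g : Γ ⧸ J)) g]
  exact mul_mem (Subgroup.mem_sup_left
    (Subgroup.subset_closure (Set.mem_union_right _ ⟨_, rfl⟩))) (hJle h1)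

/-! ### Matrix representations and strict conjugacy. -/

section Matrices

variable {Γ ι : Type*} [Fintype ι] [DecidableEq ι]

/-- The matrices of a representation in a basis. -/
noncomputable def Representation.matrixHom [Monoid Γ] {A M : Type*} [CommRing A] [AddCommGroup M]
    [Module A M] (σ : Representation A Γ M) (e : Module.Basis ι A M) : Γ →* Matrix ι ι A :=
  (LinearMap.toMatrixAlgEquiv e : Module.End A M →* Matrix ι ι A).comp σ

theorem Representation.matrixHom_apply [Monoid Γ] {A M : Type*} [CommRing A] [AddCommGroup M]
    [Module A M] (σ : Representation A Γ M) (e : Module.Basis ι A M) (g : Γ) :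
    σ.matrixHom e g = LinearMap.toMatrix e e (σ g) := rfl

theorem Representation.matrixHom_apply_apply [Monoid Γ] {A M : Type*} [CommRing A]
    [AddCommGroup M] [Module A M] (σ : Representation A Γ M) (e : Module.Basis ι A M) (g : Γ)
    (i j : ι) : σ.matrixHom e g i j = e.repr (σ g (e j)) i :=
  LinearMap.toMatrix_apply ..

/-- The application of a ring homomorphism to the entries of a matrix representation. -/
def MonoidHom.mapMatrix [Monoid Γ] {A B : Type*} [CommRing A] [CommRing B] (f : A →+* B)
    (τ : Γ →* Matrix ι ι A) : Γ →* Matrix ι ι B :=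
  (RingHom.mapMatrix (m := ι) f).toMonoidHom.comp τ

@[simp]
theorem MonoidHom.mapMatrix_apply [Monoid Γ] {A B : Type*} [CommRing A] [CommRing B] (f : A →+* B)
    (τ : Γ →* Matrix ι ι A) (g : Γ) : τ.mapMatrix f g = (τ g).map f := rfl

end Matrices

section FramedLifts

variable {W : Type u} [CommRing W] [IsLocalRing W] {Γ : Type v} [Group Γ] {ι : Type} [Fintype ι]
  [DecidableEq ι]

/-- A continuous lift over `A` of a matrix representation over the residue field. -/
structure IsFramedLift [TopologicalSpace Γ] (θ : Γ →* Matrix ι ι (ResidueField W))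
    (A : CoefficientAlgebra W) (τ : Γ →* Matrix ι ι A) : Prop where
  map_residueMap : ∀ g, (τ g).map A.residueMap = θ g
  continuous : ∀ n, ∀ᶠ g in nhds (1 : Γ), ∀ i j, (τ g - 1) i j ∈ maximalIdeal A ^ n

/-- Conjugacy of matrix representations by a matrix that reduces to the identity. -/
def IsStrictlyConj {A : CoefficientAlgebra W} (τ τ' : Γ →* Matrix ι ι A) : Prop :=
  ∃ X : Matrix ι ι A, X.map A.residueMap = 1 ∧ ∀ g, X * τ g = τ' g * X

/-- This is why strict conjugacy need not ask for an invertible matrix. -/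
theorem isUnit_det_of_map_residueMap_eq_one {A : CoefficientAlgebra W} {X : Matrix ι ι A}
    (h : X.map A.residueMap = 1) : IsUnit X.det := by
  by_contra hn
  have h1 : A.residueMap X.det = 0 := (A.residueMap_eq_zero_iff _).2 hn
  have h2 : A.residueMap X.det = (X.map A.residueMap).det :=
    RingHom.map_det A.residueMap.toRingHom X
  rw [h, Matrix.det_one, h1] at h2
  exact zero_ne_one h2

theorem IsStrictlyConj.trans {A : CoefficientAlgebra W} {τ τ' τ'' : Γ →* Matrix ι ι A}
    (h : IsStrictlyConj τ τ') (h' : IsStrictlyConj τ' τ'') : IsStrictlyConj τ τ'' := by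
  obtain ⟨X, hX, hτ⟩ := h
  obtain ⟨Y, hY, hτ'⟩ := h'
  refine ⟨Y * X, ?_, fun g => ?_⟩
  · refine (Matrix.map_mul (f := A.residueMap.toRingHom)).trans ?_
    change Y.map A.residueMap * X.map A.residueMap = 1
    rw [hX, hY, one_mul]
  · rw [mul_assoc, hτ, ← mul_assoc, hτ', mul_assoc]

/-- Ring homomorphisms, not necessarily over the same base, preserve strict conjugacy if they map
the maximal ideal into the maximal ideal. -/
theorem IsStrictlyConj.map {W' : Type*} [CommRing W'] [IsLocalRing W'] {A : CoefficientAlgebra W}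
    {B : CoefficientAlgebra W'} {τ τ' : Γ →* Matrix ι ι A} (h : IsStrictlyConj τ τ') (f : A →+* B)
    (hf : maximalIdeal A ≤ (maximalIdeal B).comap f) :
    IsStrictlyConj (τ.mapMatrix f) (τ'.mapMatrix f) := by
  obtain ⟨X, hX, hτ⟩ := h
  refine ⟨X.map f, ?_, fun g => ?_⟩
  · ext i j
    have h1 := congrFun (congrFun hX i) j
    have h2 : X i j - (1 : Matrix ι ι A) i j ∈ maximalIdeal A := by
      rw [← residueMap_eq_zero_iff, map_sub, sub_eq_zero]
      refine h1.trans ?_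
      rw [Matrix.one_apply, Matrix.one_apply]
      split_ifs <;> simp
    have h3 := hf h2
    rw [Ideal.mem_comap, ← residueMap_eq_zero_iff, map_sub, map_sub, sub_eq_zero] at h3
    refine h3.trans ?_
    rw [Matrix.one_apply, Matrix.one_apply]
    split_ifs <;> simp
  · have h1 := congrArg (fun Y => Matrix.map Y f) (hτ g)
    simpa only [Matrix.map_mul, MonoidHom.mapMatrix_apply] using h1

theorem IsFramedLift.map [TopologicalSpace Γ] {θ : Γ →* Matrix ι ι (ResidueField W)}
    {A B : CoefficientAlgebra W} {τ : Γ →* Matrix ι ι A} (h : IsFramedLift θ A τ) (α : A →ₐ[W] B) :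
    IsFramedLift θ B (τ.mapMatrix α.toRingHom) where
  map_residueMap g := by
    rw [← h.map_residueMap g]
    ext i j
    exact residueMap_comp α (τ g i j)
  continuous n := by
    filter_upwards [h.continuous n] with g hg i j
    have h1 := map_mem_maximalIdeal_pow α (hg i j)
    rw [Matrix.sub_apply, map_sub] at h1
    convert h1 using 1
    rw [Matrix.sub_apply, Matrix.one_apply, Matrix.one_apply]
    split_ifs <;> simp

end FramedLifts

/-! ### Dictionary between lifts and matrix representations. -/

namespace Lift

variable {W : Type u} [CommRing W] [IsLocalRing W] {Γ : Type v} [Group Γ] [TopologicalSpace Γ]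
  {V : Type w} [AddCommGroup V] [Module (ResidueField W) V]
  {ρ : Representation (ResidueField W) Γ V} {ι : Type} [Fintype ι] [DecidableEq ι]
  {A : CoefficientAlgebra W}

/-- A basis of a lift is adapted to a basis of `V` if it reduces to it. -/
def IsAdapted (L : Lift ρ A) (b : Module.Basis ι (ResidueField W) V)
    (e : Module.Basis ι A L.M) : Prop :=
  ∀ i, L.φ (1 ⊗ₜ e i) = b i

omit [DecidableEq ι] in
theorem φ_tmul (L : Lift ρ A) {b : Module.Basis ι (ResidueField W) V}
    (e' : Module.Basis ι A L.M) (h : ∀ i, L.φ (1 ⊗ₜ e' i) = b i) (m : L.M) (i : ι) :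
    b.repr (L.φ (1 ⊗ₜ m)) i = A.residueMap (e'.repr m i) := by
  have h1 : (1 : ResidueField W) ⊗ₜ[A] m =
      ∑ i, A.residueMap (e'.repr m i) • ((1 : ResidueField W) ⊗ₜ[A] e' i) := by
    conv_lhs => rw [← e'.sum_repr m]
    rw [TensorProduct.tmul_sum]
    refine Finset.sum_congr rfl fun i _ => ?_
    rw [TensorProduct.tmul_smul, TensorProduct.smul_tmul', TensorProduct.smul_tmul']
    congr 1
  rw [h1, map_sum, map_sum, Finset.sum_apply']
  simp only [map_smul, h, Module.Basis.repr_self, Finsupp.smul_single, smul_eq_mul, mul_one]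
  rw [Finset.sum_eq_single i] <;> simp +contextual

theorem exists_tmul_eq (L : Lift ρ A) (v : V) : ∃ m : L.M, L.φ (1 ⊗ₜ m) = v := by
  have : ∀ x : ResidueField W ⊗[A] L.M, ∃ m : L.M, 1 ⊗ₜ m = x := by
    intro x
    induction x with
    | zero => exact ⟨0, by simp⟩
    | add x y hx hy =>
      obtain ⟨m, rfl⟩ := hx
      obtain ⟨n, rfl⟩ := hy
      exact ⟨m + n, TensorProduct.tmul_add _ _ _⟩
    | tmul c m =>
      obtain ⟨a, rfl⟩ := A.residueMap_surjective c
      refine ⟨a • m, ?_⟩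
      rw [← TensorProduct.smul_tmul]
      congr 1
      rw [Algebra.smul_def, mul_one]
      rfl
  obtain ⟨m, hm⟩ := this (L.φ.symm v)
  exact ⟨m, by rw [hm, LinearEquiv.apply_symm_apply]⟩

/-- Nakayama in determinant form: preimages of the vectors of `b` have, relative to any basis, a
determinant reducing to that of a change of basis of `V`, hence a unit. -/
theorem exists_isAdapted (L : Lift ρ A) (b : Module.Basis ι (ResidueField W) V) :
    ∃ e, L.IsAdapted b e := by
  choose m hm using fun i => L.exists_tmul_eq (b i)
  let e₀ := Module.Free.chooseBasis A L.M
  let f₀ := (e₀.baseChange (ResidueField W)).map L.φ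
  have hf₀ : ∀ i, L.φ (1 ⊗ₜ e₀ i) = f₀ i := fun i => by simp [f₀]
  classical
  let r : Module.Free.ChooseBasisIndex A L.M ≃ ι := f₀.indexEquiv b
  let e₁ := e₀.reindex r
  let f₁ := f₀.reindex r
  have hf₁ : ∀ i, L.φ (1 ⊗ₜ e₁ i) = f₁ i := fun i => by simp [e₁, f₁, hf₀]
  have hmat : (e₁.toMatrix m).map A.residueMap = f₁.toMatrix b := by
    ext i j
    rw [Matrix.map_apply, Module.Basis.toMatrix_apply, Module.Basis.toMatrix_apply, ← hm j,
      L.φ_tmul e₁ hf₁]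
  have hdet : IsUnit (e₁.det m) := by
    rw [Module.Basis.det_apply]
    by_contra hn
    have h1 : A.residueMap (e₁.toMatrix m).det = 0 := (A.residueMap_eq_zero_iff _).2 hn
    have h2 : A.residueMap (e₁.toMatrix m).det = ((e₁.toMatrix m).map A.residueMap).det :=
      RingHom.map_det A.residueMap.toRingHom _
    rw [hmat, h1, ← Module.Basis.det_apply] at h2
    exact (f₁.isUnit_det b).ne_zero h2.symm
  obtain ⟨hli, hsp⟩ := e₁.is_basis_iff_det.2 hdet
  exact ⟨Module.Basis.mk hli hsp.ge, fun i => by rw [Module.Basis.mk_apply, hm]⟩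

theorem equivariant_tmul (L : Lift ρ A) (g : Γ) (m : L.M) :
    L.φ (1 ⊗ₜ L.σ g m) = ρ g (L.φ (1 ⊗ₜ m)) :=
  L.equivariant g (1 ⊗ₜ m)

theorem IsAdapted.isFramedLift [IsTopologicalGroup Γ] {L : Lift ρ A}
    {b : Module.Basis ι (ResidueField W) V}
    {e : Module.Basis ι A L.M} (h : L.IsAdapted b e) :
    IsFramedLift (ρ.matrixHom b) A (L.σ.matrixHom e) where
  map_residueMap g := by
    ext i j
    rw [Matrix.map_apply, Representation.matrixHom_apply_apply,
      Representation.matrixHom_apply_apply, ← L.φ_tmul e h, equivariant_tmul, h]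
  continuous n := by
    have h1 : ∀ᶠ g in nhds (1 : Γ), ∀ j,
        L.σ g (e j) - e j ∈ maximalIdeal A ^ n • (⊤ : Submodule A L.M) :=
      Filter.eventually_all.2 fun j => (isContinuousAction_iff L.σ).1 L.continuous n (e j)
    filter_upwards [h1] with g hg i j
    have h2 : (L.σ.matrixHom e g - 1) i j = e.repr (L.σ g (e j) - e j) i := by
      rw [Matrix.sub_apply, Representation.matrixHom_apply_apply, map_sub, Finsupp.sub_apply,
        Module.Basis.repr_self, Matrix.one_apply, Finsupp.single_apply]
      simp only [eq_comm]
    rw [h2]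
    refine Submodule.smul_induction_on (p := fun y => e.repr y i ∈ maximalIdeal A ^ n) (hg j) ?_ ?_
    · intro r hr y _
      rw [map_smul, Finsupp.smul_apply]
      exact Ideal.mul_mem_right _ _ hr
    · intro x y hx hy
      rw [map_add]
      exact add_mem hx hy

theorem exists_of_isFramedLift [IsTopologicalGroup Γ] (b : Module.Basis ι (ResidueField W) V)
    {τ : Γ →* Matrix ι ι A} (h : IsFramedLift (ρ.matrixHom b) A τ) :
    ∃ (L : Lift ρ A) (e : Module.Basis ι A L.M), L.IsAdapted b e ∧ L.σ.matrixHom e = τ := by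
  let e : Module.Basis ι A (ι → A) := Pi.basisFun A ι
  let σ : Representation A Γ (ι → A) :=
    ((Matrix.toLinAlgEquiv e : Matrix ι ι A →* Module.End A (ι → A))).comp τ
  have hσ : σ.matrixHom e = τ := MonoidHom.ext fun g =>
    (Matrix.toLinAlgEquiv e).symm_apply_apply (τ g)
  have hrepr : ∀ g j i, e.repr (σ g (e j)) i = τ g i j := fun g j i => by
    rw [← Representation.matrixHom_apply_apply, hσ]
  have hsum : ∀ g j, σ g (e j) = ∑ i, τ g i j • e i := fun g j => by
    rw [← e.sum_repr (σ g (e j))]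
    simp only [hrepr]
  let φ : ResidueField W ⊗[A] (ι → A) ≃ₗ[ResidueField W] V :=
    (e.baseChange (ResidueField W)).equiv b (Equiv.refl ι)
  have hφ : ∀ i, φ (1 ⊗ₜ e i) = b i := fun i => by
    have := (e.baseChange (ResidueField W)).equiv_apply i b (Equiv.refl ι)
    rwa [Module.Basis.baseChange_apply] at this
  refine ⟨{ M := ι → A, σ := σ, continuous := ?_, φ := φ, equivariant := ?_ }, e, hφ, hσ⟩
  · rw [isContinuousAction_iff]
    intro n m
    filter_upwards [h.continuous n] with g hg
    have h1 : σ g m - m = ∑ j, ∑ i, ((τ g - 1) i j * e.repr m j) • e i := by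
      have h2 : ∀ j, σ g (e j) - e j = ∑ i, (τ g - 1) i j • e i := fun j => by
        rw [hsum]
        simp only [Matrix.sub_apply, sub_smul, Finset.sum_sub_distrib, Matrix.one_apply, ite_smul,
          one_smul, zero_smul, Finset.sum_ite_eq', Finset.mem_univ, if_true]
      conv_lhs => rw [← e.sum_repr m]
      rw [map_sum, ← Finset.sum_sub_distrib]
      refine Finset.sum_congr rfl fun j _ => ?_
      rw [map_smul, ← smul_sub, h2, Finset.smul_sum]
      refine Finset.sum_congr rfl fun i _ => ?_
      rw [smul_smul, mul_comm]
    rw [h1]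
    exact sum_mem fun j _ => sum_mem fun i _ =>
      Submodule.smul_mem_smul (Ideal.mul_mem_right _ _ (hg i j)) trivial
  · intro g
    have h1 : φ.toLinearMap ∘ₗ σ.extendScalars (ResidueField W) g = ρ g ∘ₗ φ.toLinearMap := by
      refine (e.baseChange (ResidueField W)).ext fun j => ?_
      rw [Module.Basis.baseChange_apply]
      change φ (1 ⊗ₜ σ g (e j)) = ρ g (φ (1 ⊗ₜ e j))
      rw [hφ, ← b.sum_repr (ρ g (b j)), hsum, TensorProduct.tmul_sum, map_sum]
      refine Finset.sum_congr rfl fun i _ => ?_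
      rw [← Representation.matrixHom_apply_apply, ← h.map_residueMap, Matrix.map_apply, ← hφ,
        ← φ.map_smul, TensorProduct.tmul_smul, TensorProduct.smul_tmul', TensorProduct.smul_tmul']
      congr 2
    exact fun x => LinearMap.congr_fun h1 x

/-- In adapted bases, compatibility with the maps to `V` says exactly that the matrix reduces to the
identity, and equivariance is the intertwining relation. -/
theorem IsAdapted.isIsomorphic_iff {L L' : Lift ρ A} {b : Module.Basis ι (ResidueField W) V}
    {e : Module.Basis ι A L.M} {e' : Module.Basis ι A L'.M} (h : L.IsAdapted b e)
    (h' : L'.IsAdapted b e') :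
    L.IsIsomorphic L' ↔ IsStrictlyConj (L.σ.matrixHom e) (L'.σ.matrixHom e') := by
  constructor
  · rintro ⟨f, hf, hφ⟩
    refine ⟨LinearMap.toMatrix e e' f, ?_, fun g => ?_⟩
    · ext i j
      rw [Matrix.map_apply, LinearMap.toMatrix_apply, ← L'.φ_tmul e' h']
      have h1 := hφ (1 ⊗ₜ e j)
      rw [LinearMap.baseChange_tmul, h] at h1
      rw [h1, Module.Basis.repr_self, Finsupp.single_apply, Matrix.one_apply]
      simp only [eq_comm]
    · rw [Representation.matrixHom_apply, Representation.matrixHom_apply,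
        ← LinearMap.toMatrix_comp, ← LinearMap.toMatrix_comp]
      congr 1
      ext m
      exact hf g m
  · rintro ⟨X, hX, hconj⟩
    have hu : IsUnit (LinearMap.toMatrix e e' (Matrix.toLin e e' X)).det := by
      rw [LinearMap.toMatrix_toLin]
      exact isUnit_det_of_map_residueMap_eq_one hX
    let f := LinearEquiv.ofIsUnitDet hu
    have hf : (f : L.M →ₗ[A] L'.M) = Matrix.toLin e e' X := rfl
    refine ⟨f, fun g m => ?_, ?_⟩
    · have h1 : (f : L.M →ₗ[A] L'.M) ∘ₗ L.σ g = L'.σ g ∘ₗ (f : L.M →ₗ[A] L'.M) := by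
        apply (LinearMap.toMatrix e e').injective
        rw [LinearMap.toMatrix_comp e e e', LinearMap.toMatrix_comp e e' e', hf,
          LinearMap.toMatrix_toLin]
        exact hconj g
      exact LinearMap.congr_fun h1 m
    · have h1 : L'.φ.toLinearMap ∘ₗ (f : L.M →ₗ[A] L'.M).baseChange (ResidueField W) =
          L.φ.toLinearMap := by
        refine (e.baseChange (ResidueField W)).ext fun j => ?_
        rw [Module.Basis.baseChange_apply]
        change L'.φ (1 ⊗ₜ Matrix.toLin e e' X (e j)) = L.φ (1 ⊗ₜ e j)
        apply b.repr.injective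
        ext i
        rw [L'.φ_tmul e' h', h, Module.Basis.repr_self, Matrix.toLin_self, map_sum,
          Finset.sum_apply']
        have hij := congrFun (congrFun hX i) j
        rw [Matrix.map_apply, Matrix.one_apply] at hij
        simp only [map_smul, Module.Basis.repr_self, Finsupp.smul_single, smul_eq_mul, mul_one,
          Finsupp.single_apply, Finset.sum_ite_eq', Finset.mem_univ, if_true, hij]
        simp only [eq_comm]
      exact fun x => LinearMap.congr_fun h1 x

theorem IsAdapted.exists_baseChange [IsTopologicalGroup Γ] {L : Lift ρ A}
    {b : Module.Basis ι (ResidueField W) V} {e : Module.Basis ι A L.M} (h : L.IsAdapted b e)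
    {A' : CoefficientAlgebra W} (α : A →ₐ[W] A') :
    ∃ e', (L.baseChange α).IsAdapted b e' ∧
      (L.baseChange α).σ.matrixHom e' = (L.σ.matrixHom e).mapMatrix α.toRingHom := by
  let : Algebra A A' := α.toRingHom.toAlgebra
  have : IsScalarTower A A' (ResidueField W) :=
    .of_algebraMap_eq fun a => (CoefficientAlgebra.residueMap_comp α a).symm
  let e' : Module.Basis ι A' (A' ⊗[A] L.M) := e.baseChange A'
  refine ⟨e', fun i => ?_, ?_⟩
  · change L.φ (TensorProduct.AlgebraTensorModule.cancelBaseChange A A' (ResidueField W)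
      (ResidueField W) L.M (1 ⊗ₜ e' i)) = b i
    rw [Module.Basis.baseChange_apply, TensorProduct.AlgebraTensorModule.cancelBaseChange_tmul,
      one_smul, h]
  · refine MonoidHom.ext fun g => Matrix.ext fun i j => ?_
    refine (Representation.matrixHom_apply_apply (L.baseChange α).σ e' g i j).trans ?_
    rw [MonoidHom.mapMatrix_apply, Matrix.map_apply, Representation.matrixHom_apply_apply]
    change e'.repr (L.σ.extendScalars A' g (e' j)) i = α (e.repr (L.σ g (e j)) i)
    have h1 : L.σ.extendScalars A' g (e' j) = 1 ⊗ₜ[A] L.σ g (e j) := by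
      rw [Module.Basis.baseChange_apply]; rfl
    rw [h1, Module.Basis.baseChange_repr_tmul, Algebra.smul_def, mul_one]
    rfl

end Lift

/-- Versality in terms of matrix representations. -/
theorem isVersalDeformationRing_iff {W : Type u} [CommRing W] [IsLocalRing W] {Γ : Type v}
    [Group Γ] [TopologicalSpace Γ] [IsTopologicalGroup Γ] {V : Type w} [AddCommGroup V]
    [Module (ResidueField W) V] (ρ : Representation (ResidueField W) Γ V) {ι : Type} [Fintype ι]
    [DecidableEq ι] (b : Module.Basis ι (ResidueField W) V) (R : CoefficientAlgebra W) :
    IsVersalDeformationRing ρ R ↔ ∃ τ : Γ →* Matrix ι ι R, IsFramedLift (ρ.matrixHom b) R τ ∧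
      (∀ (A : CoefficientAlgebra W) (τ' : Γ →* Matrix ι ι A), IsFramedLift (ρ.matrixHom b) A τ' →
        ∃ α : R →ₐ[W] A, IsStrictlyConj (τ.mapMatrix α.toRingHom) τ') ∧
      ∀ α β : R →ₐ[W] dualNumber W,
        IsStrictlyConj (τ.mapMatrix α.toRingHom) (τ.mapMatrix β.toRingHom) → α = β := by
  -- The equivalence for one fixed lift and adapted basis. Surjectivity over `k[ε]` is an instance
  -- of surjectivity in general, so only injectivity remains as a second clause.
  have key : ∀ (U : Lift ρ R) (e : Module.Basis ι R U.M), U.IsAdapted b e →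
      (((∀ A : CoefficientAlgebra W, Function.Surjective (U.toDeformations A)) ∧
        Function.Bijective (U.toDeformations (dualNumber W))) ↔
      (∀ (A : CoefficientAlgebra W) (τ' : Γ →* Matrix ι ι A), IsFramedLift (ρ.matrixHom b) A τ' →
        ∃ α : R →ₐ[W] A, IsStrictlyConj ((U.σ.matrixHom e).mapMatrix α.toRingHom) τ') ∧
      ∀ α β : R →ₐ[W] dualNumber W,
        IsStrictlyConj ((U.σ.matrixHom e).mapMatrix α.toRingHom)
          ((U.σ.matrixHom e).mapMatrix β.toRingHom) → α = β) := by
    intro U e he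
    constructor
    · rintro ⟨hs, hi, -⟩
      refine ⟨fun A τ' hτ' => ?_, fun α β hαβ => hi (Quotient.sound ?_)⟩
      · obtain ⟨L, e', he', rfl⟩ := Lift.exists_of_isFramedLift b hτ'
        obtain ⟨α, hα⟩ := hs A (Quotient.mk _ L)
        obtain ⟨e'', he'', hτ''⟩ := he.exists_baseChange α
        refine ⟨α, ?_⟩
        rw [← hτ'']
        exact (he''.isIsomorphic_iff he').1 (Quotient.exact hα)
      · obtain ⟨eα, heα, hτα⟩ := he.exists_baseChange α
        obtain ⟨eβ, heβ, hτβ⟩ := he.exists_baseChange β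
        refine (heα.isIsomorphic_iff heβ).2 ?_
        rwa [hτα, hτβ]
    · rintro ⟨hs, hi⟩
      have hs' : ∀ A : CoefficientAlgebra W, Function.Surjective (U.toDeformations A) := by
        intro A x
        obtain ⟨L, rfl⟩ := Quotient.exists_rep x
        obtain ⟨e', he'⟩ := L.exists_isAdapted b
        obtain ⟨α, hα⟩ := hs A _ he'.isFramedLift
        obtain ⟨e'', he'', hτ''⟩ := he.exists_baseChange α
        refine ⟨α, Quotient.sound ((he''.isIsomorphic_iff he').2 ?_)⟩
        rwa [hτ'']
      refine ⟨hs', fun α β hαβ => hi α β ?_, hs' _⟩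
      obtain ⟨eα, heα, hτα⟩ := he.exists_baseChange α
      obtain ⟨eβ, heβ, hτβ⟩ := he.exists_baseChange β
      rw [← hτα, ← hτβ]
      exact (heα.isIsomorphic_iff heβ).1 (Quotient.exact hαβ)
  constructor
  · rintro ⟨U, hU⟩
    obtain ⟨e, he⟩ := U.exists_isAdapted b
    exact ⟨_, he.isFramedLift, (key U e he).1 hU⟩
  · rintro ⟨τ, hτ, h⟩
    obtain ⟨U, e, he, rfl⟩ := Lift.exists_of_isFramedLift b hτ
    exact ⟨U, (key U e he).2 h⟩

/-! ### Tangent spaces and uniqueness of versal rings. -/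

/-- The kernels of the iterates stabilise at some `n`. An element of `ker f`, written as `f ^ n` of
`y`, has `y` in the kernel of `f ^ (n + 1)`, which is that of `f ^ n`. -/
theorem IsNoetherianRing.injective_of_surjective_ringEnd {R : Type*} [CommRing R]
    [IsNoetherianRing R] (f : R →+* R) (hf : Function.Surjective f) : Function.Injective f := by
  let K : ℕ →o Ideal R := ⟨fun n => RingHom.ker (f ^ n), monotone_nat_of_le_succ fun n x hx => by
    rw [RingHom.mem_ker, pow_succ', RingHom.mul_def, RingHom.comp_apply,
      (RingHom.mem_ker).1 hx, map_zero]⟩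
  obtain ⟨n, hn⟩ := monotone_stabilizes_iff_noetherian.2 ‹IsNoetherianRing R› K
  have hsurj : Function.Surjective (f ^ n) := by
    rw [RingHom.coe_pow]
    exact hf.iterate n
  rw [injective_iff_map_eq_zero]
  intro x hx
  obtain ⟨y, rfl⟩ := hsurj x
  have h1 : y ∈ K (n + 1) := by
    change (f ^ (n + 1)) y = 0
    rw [pow_succ', RingHom.mul_def, RingHom.comp_apply, hx]
  rw [← hn (n + 1) n.le_succ] at h1
  exact h1

section Tangent

variable {W : Type u} [CommRing W] [IsLocalRing W]

/-- An endomorphism in `Ĉ_W` acting trivially on the tangent space is the identity modulo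
`𝔪_R² + 𝔪_W R`. -/
theorem sub_mem_of_comp_eq {R : CoefficientAlgebra W} (γ : R →ₐ[W] R)
    (hγ : ∀ δ : R →ₐ[W] dualNumber W, δ.comp γ = δ) (x : R) :
    γ x - x ∈ maximalIdeal R ^ 2 ⊔ (maximalIdeal W).map (algebraMap W R) := by
  set I : Ideal R := maximalIdeal R ^ 2 ⊔ (maximalIdeal W).map (algebraMap W R)
  -- Since `I` contains the image of the maximal ideal of `W`, the quotient is a `k`-algebra; `E`
  -- below is the projection off the constants.
  let s : ResidueField W →+* R ⧸ I :=
    Ideal.Quotient.lift (maximalIdeal W) (algebraMap W (R ⧸ I)) fun w hw =>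
      Ideal.Quotient.eq_zero_iff_mem.2 (Ideal.mem_sup_right (Ideal.mem_map_of_mem _ hw))
  have hs : ∀ w, s (residue W w) = Ideal.Quotient.mk I (algebraMap W R w) := fun w => rfl
  let : Algebra (ResidueField W) (R ⧸ I) := s.toAlgebra
  have hsmul : ∀ c y, c • y = s c * y := fun _ _ => rfl
  let E : R →+ R ⧸ I := (Ideal.Quotient.mk I).toAddMonoidHom -
    (s.comp R.residueMap.toRingHom).toAddMonoidHom
  have hE : ∀ a, E a = Ideal.Quotient.mk I a - s (R.residueMap a) := fun _ => rfl
  have hEm : ∀ a, ∃ a' ∈ maximalIdeal R, E a = Ideal.Quotient.mk I a' := fun a => by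
    obtain ⟨w, hw⟩ := R.exists_sub_algebraMap_mem a
    have h1 : R.residueMap a = residue W w := by
      rw [← residueMap_eq_zero_iff, map_sub, AlgHom.commutes, sub_eq_zero] at hw
      exact hw
    refine ⟨_, hw, ?_⟩
    rw [hE, h1, hs, map_sub]
  have hEE : ∀ a b, E a * E b = 0 := fun a b => by
    obtain ⟨a', ha, ha'⟩ := hEm a
    obtain ⟨b', hb, hb'⟩ := hEm b
    rw [ha', hb', ← map_mul, Ideal.Quotient.eq_zero_iff_mem]
    exact Ideal.mem_sup_left (pow_two (maximalIdeal R) ▸ Ideal.mul_mem_mul ha hb)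
  -- `E a * E b = 0`, written out, is the Leibniz rule.
  have hEmul : ∀ a b, E (a * b) = R.residueMap a • E b + R.residueMap b • E a := fun a b => by
    have h := hEE a b
    simp only [hE, hsmul, map_mul] at h ⊢
    linear_combination h
  have hEW : ∀ w, E (algebraMap W R w) = 0 := fun w => by
    rw [hE, AlgHom.commutes, ← hs, sub_eq_zero]
    rfl
  -- Each functional `l` gives a derivation `l ∘ E`, hence a map to `k[ε]` unchanged by `γ`;
  -- functionals separate points of `R ⧸ I`.
  have key : ∀ l : Module.Dual (ResidueField W) (R ⧸ I), l (E (γ x) - E x) = 0 := fun l => by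
    let δ := R.dualNumberHom (l.toAddMonoidHom.comp E) (fun a b => by
      change l (E (a * b)) = _ * l (E b) + _ * l (E a)
      rw [hEmul, map_add, map_smul, map_smul]; rfl) (fun w => by
      change l (E (algebraMap W R w)) = 0
      rw [hEW, map_zero])
    have h1 := congrArg epsCoeff (DFunLike.congr_fun (hγ δ) x)
    have h2 : l (E (γ x)) = l (E x) := h1
    rw [map_sub, h2, sub_self]
  have h1 := (Module.forall_dual_apply_eq_zero_iff (ResidueField W) _).1 key
  rw [hE, hE, residueMap_comp, sub_sub_sub_cancel_right, ← map_sub] at h1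
  exact Ideal.Quotient.eq_zero_iff_mem.1 h1

/-- Since `γ` is the identity modulo `𝔪_R² + 𝔪_W R`, Nakayama shows that `γ(𝔪_R)` generates `𝔪_R`.
Completeness then gives surjectivity, and Noetherianity injectivity. -/
theorem bijective_of_comp_eq {R : CoefficientAlgebra W} (γ : R →ₐ[W] R)
    (hγ : ∀ δ : R →ₐ[W] dualNumber W, δ.comp γ = δ) : Function.Bijective γ := by
  have hle : (maximalIdeal R).map γ.toRingHom ≤ maximalIdeal R :=
    Ideal.map_le_iff_le_comap.2 fun x hx => map_mem_maximalIdeal γ hx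
  have hmap : (maximalIdeal R).map γ.toRingHom = maximalIdeal R := by
    refine le_antisymm hle (Submodule.le_of_le_smul_of_le_jacobson_bot (I := maximalIdeal R)
      (Ideal.fg_of_isNoetherianRing _) (IsLocalRing.maximalIdeal_le_jacobson _) fun x hx => ?_)
    have hW : (maximalIdeal W).map (algebraMap W R) ≤ (maximalIdeal R).map γ.toRingHom :=
      Ideal.map_le_iff_le_comap.2 fun w hw => by
        rw [Ideal.mem_comap, ← γ.commutes]
        refine Ideal.mem_map_of_mem γ.toRingHom ?_
        rw [← residueMap_eq_zero_iff, AlgHom.commutes]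
        exact (residue_eq_zero_iff w).2 hw
    have h1 := sub_mem_of_comp_eq γ hγ x
    have h2 : maximalIdeal R ^ 2 ⊔ (maximalIdeal W).map (algebraMap W R) ≤
        (maximalIdeal R).map γ.toRingHom ⊔ maximalIdeal R • maximalIdeal R := by
      rw [sup_comm, pow_two]
      exact sup_le_sup hW le_rfl
    have h3 := sub_mem (Ideal.mem_sup_left (Ideal.mem_map_of_mem γ.toRingHom hx)) (h2 h1)
    rwa [show γ.toRingHom x = γ x from rfl, sub_sub_cancel] at h3
  have hsurj : Function.Surjective γ.toRingHom := by
    have : IsHausdorff ((maximalIdeal R).map γ.toRingHom) R := by rw [hmap]; infer_instance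
    refine surjective_of_mk_map_comp_surjective (I := maximalIdeal R) γ.toRingHom fun y => ?_
    obtain ⟨y, rfl⟩ := Ideal.Quotient.mk_surjective y
    obtain ⟨w, hw⟩ := R.exists_sub_algebraMap_mem y
    refine ⟨algebraMap W R w, ?_⟩
    rw [RingHom.comp_apply, eq_comm, Ideal.Quotient.eq, hmap]
    rwa [show γ.toRingHom (algebraMap W R w) = _ from γ.commutes w]
  exact ⟨IsNoetherianRing.injective_of_surjective_ringEnd γ.toRingHom hsurj, hsurj⟩

end Tangent

section Uniqueness

variable {W : Type u} [CommRing W] [IsLocalRing W] {Γ : Type v} [Group Γ] [TopologicalSpace Γ]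
  [IsTopologicalGroup Γ] {V : Type w} [AddCommGroup V] [Module (ResidueField W) V]
  [FiniteDimensional (ResidueField W) V] {ρ : Representation (ResidueField W) Γ V}

/-- Versal deformation rings are unique up to isomorphism. -/
theorem IsVersalDeformationRing.nonempty_algEquiv {R₁ R₂ : CoefficientAlgebra W}
    (h₁ : IsVersalDeformationRing ρ R₁) (h₂ : IsVersalDeformationRing ρ R₂) :
    Nonempty (R₁ ≃ₐ[W] R₂) := by
  let b := Module.finBasis (ResidueField W) V
  obtain ⟨τ₁, hτ₁, hs₁, hi₁⟩ := (isVersalDeformationRing_iff ρ b R₁).1 h₁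
  obtain ⟨τ₂, hτ₂, hs₂, hi₂⟩ := (isVersalDeformationRing_iff ρ b R₂).1 h₂
  obtain ⟨α, hα⟩ := hs₁ R₂ τ₂ hτ₂
  obtain ⟨β, hβ⟩ := hs₂ R₁ τ₁ hτ₁
  have hle : ∀ {A B : CoefficientAlgebra W} (f : A →ₐ[W] B),
      maximalIdeal A ≤ (maximalIdeal B).comap f.toRingHom := fun f _ h => map_mem_maximalIdeal f h
  -- The composite carries the versal lift to a strictly conjugate one, so `δ` and `δ ∘ β ∘ α`
  -- induce the same deformation over `k[ε]`.
  have h1 : ∀ δ : R₁ →ₐ[W] dualNumber W, δ.comp (β.comp α) = δ := fun δ => hi₁ _ _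
    (((hα.map β.toRingHom (hle β)).trans hβ).map δ.toRingHom (hle δ))
  have h2 : ∀ δ : R₂ →ₐ[W] dualNumber W, δ.comp (α.comp β) = δ := fun δ => hi₂ _ _
    (((hβ.map α.toRingHom (hle α)).trans hα).map δ.toRingHom (hle δ))
  have hinj : Function.Injective α :=
    Function.Injective.of_comp (f := β) (bijective_of_comp_eq _ h1).1
  have hsurj : Function.Surjective α :=
    Function.Surjective.of_comp (g := β) (bijective_of_comp_eq _ h2).2
  exact ⟨AlgEquiv.ofBijective α ⟨hinj, hsurj⟩⟩

theorem IsVersalDeformationRing.of_algEquiv {R₁ R₂ : CoefficientAlgebra W}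
    (h₁ : IsVersalDeformationRing ρ R₁) (e : R₁ ≃ₐ[W] R₂) : IsVersalDeformationRing ρ R₂ := by
  let b := Module.finBasis (ResidueField W) V
  obtain ⟨τ, hτ, hs, hi⟩ := (isVersalDeformationRing_iff ρ b R₁).1 h₁
  have he : ∀ {A : CoefficientAlgebra W} (α : R₂ →ₐ[W] A),
      (τ.mapMatrix e.toAlgHom.toRingHom).mapMatrix α.toRingHom =
        τ.mapMatrix (α.comp e.toAlgHom).toRingHom := fun α => rfl
  refine (isVersalDeformationRing_iff ρ b R₂).2 ⟨τ.mapMatrix e.toAlgHom.toRingHom,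
    hτ.map e.toAlgHom, fun A τ' hτ' => ?_, fun α β hαβ => ?_⟩
  · obtain ⟨α, hα⟩ := hs A τ' hτ'
    refine ⟨α.comp e.symm.toAlgHom, ?_⟩
    have : (α.comp e.symm.toAlgHom).comp e.toAlgHom = α :=
      AlgHom.ext fun x => congrArg α (e.symm_apply_apply x)
    rwa [he, this]
  · rw [he, he] at hαβ
    have h1 := hi _ _ hαβ
    refine AlgHom.ext fun x => ?_
    have h2 : α (e (e.symm x)) = β (e (e.symm x)) := DFunLike.congr_fun h1 (e.symm x)
    rwa [e.apply_symm_apply] at h2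

end Uniqueness

/-! ### Congruence subgroups and descent of lifts. -/

section MatrixEntries

variable {ι A : Type*} [Fintype ι] [DecidableEq ι] [CommRing A]

omit [DecidableEq ι] in
theorem Matrix.mul_apply_mem_ideal_mul {I J : Ideal A} {X Y : Matrix ι ι A}
    (hX : ∀ i j, X i j ∈ I) (hY : ∀ i j, Y i j ∈ J) (i j : ι) : (X * Y) i j ∈ I * J := by
  rw [Matrix.mul_apply]
  exact sum_mem fun l _ => Ideal.mul_mem_mul (hX i l) (hY l j)

theorem exists_one_add_pow_eq {M : Type*} [Ring M] (Y : M) (n : ℕ) :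
    ∃ Z, (1 + Y) ^ n = 1 + n * Y + Y * Y * Z := by
  induction n with
  | zero => exact ⟨0, by simp⟩
  | succ n ih =>
    obtain ⟨Z, hZ⟩ := ih
    refine ⟨Z + n + Z * Y, ?_⟩
    rw [pow_succ, hZ, Nat.cast_succ, ← sub_eq_zero]
    have h : (n : M) * Y = Y * n := Nat.cast_comm n Y
    noncomm_ring
    rw [← mul_assoc (n : M), h, mul_assoc, h, neg_one_smul, add_neg_cancel]

/-- Raising to the `p`-th power improves congruences to the identity matrix. -/
theorem Matrix.pow_sub_one_apply_mem {m : Ideal A} {p : ℕ} (hp : (p : A) ∈ m) {X : Matrix ι ι A}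
    {k : ℕ} (hX : ∀ i j, (X - 1) i j ∈ m ^ (k + 1)) (i j : ι) :
    (X ^ p - 1) i j ∈ m ^ (k + 2) := by
  obtain ⟨Z, hZ⟩ := exists_one_add_pow_eq (X - 1) p
  have e : X ^ p - 1 = (p : A) • (X - 1) + (X - 1) * (X - 1) * Z := by
    rw [add_sub_cancel] at hZ
    rw [hZ, add_assoc, add_sub_cancel_left, ← nsmul_eq_mul, Nat.cast_smul_eq_nsmul]
  rw [e, Matrix.add_apply, Matrix.smul_apply, smul_eq_mul]
  -- The linear term gains a factor `p ∈ m`; the quadratic one lies in `m ^ (2k + 2)`, which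
  -- suffices because the congruence starts at exponent `k + 1 ≥ 1`.
  refine add_mem ?_ ?_
  · rw [show k + 2 = 1 + (k + 1) by omega, pow_add, pow_one]
    exact Ideal.mul_mem_mul hp (hX i j)
  · have h := Matrix.mul_apply_mem_ideal_mul (Y := Z) (J := ⊤)
      (Matrix.mul_apply_mem_ideal_mul hX hX) (fun _ _ => trivial) i j
    rw [Ideal.mul_top, ← pow_add] at h
    exact Ideal.pow_le_pow_right (by omega) h

end MatrixEntries

section Descent

variable {W : Type u} [CommRing W] [IsLocalRing W] {W' : Type u} [CommRing W']
  [IsLocalRing W'] [Algebra W W'] [IsLocalHom (algebraMap W W')]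
  {Γ : Type v} [Group Γ] [TopologicalSpace Γ] {ι : Type} [Fintype ι] [DecidableEq ι]

theorem IsFramedLift.map_of_ringHom {θ : Γ →* Matrix ι ι (ResidueField W)}
    {A : CoefficientAlgebra W} {A' : CoefficientAlgebra W'} {τ : Γ →* Matrix ι ι A}
    (h : IsFramedLift θ A τ) (j : A →+* A')
    (hj : ∀ w, j (algebraMap W A w) = algebraMap W' A' (algebraMap W W' w))
    (hm : maximalIdeal A ≤ (maximalIdeal A').comap j) :
    IsFramedLift (θ.mapMatrix (algebraMap (ResidueField W) (ResidueField W'))) A'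
      (τ.mapMatrix j) where
  map_residueMap g := by
    ext i l
    rw [Matrix.map_apply, MonoidHom.mapMatrix_apply, MonoidHom.mapMatrix_apply, Matrix.map_apply,
      residueMap_map_eq j hj hm, ← h.map_residueMap g]
    rfl
  continuous n := by
    filter_upwards [h.continuous n] with g hg i l
    have h1 := ((Ideal.pow_right_mono hm n).trans (Ideal.le_comap_pow _ n)) (hg i l)
    rw [Ideal.mem_comap, Matrix.sub_apply, map_sub] at h1
    convert h1 using 1
    rw [Matrix.sub_apply, Matrix.one_apply, Matrix.one_apply]
    split_ifs <;> simp

/-- The subgroup of elements whose matrices are congruent to the identity modulo `𝔪_A ^ n`. -/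
def congruenceKernel {A : CoefficientAlgebra W} (τ : Γ →* Matrix ι ι A) (n : ℕ) : Subgroup Γ :=
  (τ.mapMatrix (Ideal.Quotient.mk (maximalIdeal A ^ n))).ker

omit [TopologicalSpace Γ] in
theorem mem_congruenceKernel {A : CoefficientAlgebra W} {τ : Γ →* Matrix ι ι A} {n : ℕ} {g : Γ} :
    g ∈ congruenceKernel τ n ↔ ∀ i j, (τ g - 1) i j ∈ maximalIdeal A ^ n := by
  rw [congruenceKernel, MonoidHom.mem_ker, ← Matrix.ext_iff]
  refine forall_congr' fun i => forall_congr' fun j => ?_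
  rw [← Ideal.Quotient.eq_zero_iff_mem, Matrix.sub_apply, map_sub, sub_eq_zero,
    MonoidHom.mapMatrix_apply, Matrix.map_apply, Matrix.one_apply, Matrix.one_apply]
  split_ifs <;> simp

/-- Under the `p`-finiteness condition, the image of a framed lift is topologically generated by
finitely many elements. -/
theorem IsFramedLift.exists_finite_generating {p : ℕ} [Fact p.Prime] [IsTopologicalGroup Γ]
    [CompactSpace Γ] (hΓ : IsPFinite p Γ) [CharP (ResidueField W) p]
    {θ : Γ →* Matrix ι ι (ResidueField W)} {A : CoefficientAlgebra W} {τ : Γ →* Matrix ι ι A}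
    (h : IsFramedLift θ A τ) :
    ∃ S : Set Γ, S.Finite ∧ ∀ g n, ∃ s ∈ Subgroup.closure S,
      ∀ i j, (τ g - τ s) i j ∈ maximalIdeal A ^ n := by
  have hopen : ∀ n, IsOpen (congruenceKernel τ n : Set Γ) := fun n =>
    Subgroup.isOpen_of_mem_nhds _ (g := 1) (by
      filter_upwards [h.continuous n] with g hg
      exact mem_congruenceKernel.2 hg)
  have hp : (p : A) ∈ maximalIdeal A := by
    rw [← residueMap_eq_zero_iff, map_natCast, CharP.cast_eq_zero]
  have hpow : ∀ g ∈ congruenceKernel τ 1, ∀ k, g ^ p ^ k ∈ congruenceKernel τ (k + 1) := by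
    intro g hg k
    induction k with
    | zero => simpa using hg
    | succ k ih =>
      rw [pow_succ, pow_mul, mem_congruenceKernel, map_pow]
      exact Matrix.pow_sub_one_apply_mem hp (mem_congruenceKernel.1 ih)
  obtain ⟨S, hS, hgen⟩ := hΓ.exists_finite_closure_sup_eq_top _ (hopen 1)
  refine ⟨S, hS, fun g n => ?_⟩
  -- Here `J` is the kernel of `θ`; its `p ^ n`-th powers lie in level `n + 1`, so its image modulo
  -- level `n` is a `p`-group.
  have htop := hgen (congruenceKernel τ n) (MonoidHom.normal_ker _) (hopen n) fun g hg =>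
    ⟨n, mem_congruenceKernel.2 fun i j =>
      Ideal.pow_le_pow_right n.le_succ (mem_congruenceKernel.1 (hpow g hg n) i j)⟩
  have hn : (congruenceKernel τ n).Normal := MonoidHom.normal_ker _
  obtain ⟨s, hs, ν, hν, rfl⟩ := Subgroup.mem_sup_of_normal_right.1 (htop ▸ Subgroup.mem_top g)
  refine ⟨s, hs, fun i j => ?_⟩
  have h1 := Matrix.mul_apply_mem_ideal_mul (I := ⊤) (X := τ s) (fun _ _ => trivial)
    (mem_congruenceKernel.1 hν) i j
  rw [Ideal.top_mul, mul_sub, mul_one] at h1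
  rwa [map_mul]

/-- A framed lift over an object of `Ĉ_{W'}` of a representation defined over the residue field
of `W` is defined over an object of `Ĉ_W`. -/
theorem IsFramedLift.exists_descent [IsNoetherianRing W] {p : ℕ} [Fact p.Prime]
    [IsTopologicalGroup Γ] [CompactSpace Γ] (hΓ : IsPFinite p Γ) [CharP (ResidueField W') p]
    {θ : Γ →* Matrix ι ι (ResidueField W)} {A' : CoefficientAlgebra W'} {τ' : Γ →* Matrix ι ι A'}
    (h : IsFramedLift (θ.mapMatrix (algebraMap (ResidueField W) (ResidueField W'))) A' τ') :
    ∃ (A : CoefficientAlgebra W) (j : A →+* A') (τ : Γ →* Matrix ι ι A),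
      (∀ w, j (algebraMap W A w) = algebraMap W' A' (algebraMap W W' w)) ∧
      maximalIdeal A ≤ (maximalIdeal A').comap j ∧ IsFramedLift θ A τ ∧ τ.mapMatrix j = τ' := by
  obtain ⟨S, hS, hgen⟩ := h.exists_finite_generating hΓ
  -- Inverses are added so that the subgroup is generated as a monoid, and entries of inverse
  -- matrices never have to be computed.
  obtain ⟨N, s, -, hs⟩ := (hS.union hS.inv).fin_param
  choose c hc using fun x : Fin N × ι × ι => residue_surjective (θ (s x.1) x.2.1 x.2.2)
  -- The reductions of the entries come from `k`, so subtracting constants lifted to `W` moves them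
  -- into the maximal ideal.
  let e : Fin N × ι × ι → A' := fun x =>
    τ' (s x.1) x.2.1 x.2.2 - algebraMap W' A' (algebraMap W W' (c x))
  have he : ∀ x, e x ∈ maximalIdeal A' := fun x => by
    have h1 : A'.residueMap (τ' (s x.1) x.2.1 x.2.2) =
        algebraMap (ResidueField W) (ResidueField W') (θ (s x.1) x.2.1 x.2.2) :=
      congrFun (congrFun (h.map_residueMap (s x.1)) x.2.1) x.2.2
    rw [← residueMap_eq_zero_iff, map_sub, h1, ← hc, AlgHom.commutes, sub_eq_zero]
    rfl
  obtain ⟨A, j, hinj, hj, hm, hrange⟩ := exists_coefficientAlgebra_subring (W := W) A' e he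
  have hclosure : ∀ g ∈ Subgroup.closure S, ∀ i l, τ' g i l ∈ j.range := by
    intro g hg
    rw [← Subgroup.mem_toSubmonoid, Subgroup.closure_toSubmonoid, ← hs] at hg
    induction hg using Submonoid.closure_induction with
    | mem g hg =>
      obtain ⟨x, rfl⟩ := hg
      intro i l
      have h1 := add_mem (hrange (x, i, l)) (⟨algebraMap W A (c (x, i, l)), rfl⟩ :
        j (algebraMap W A (c (x, i, l))) ∈ j.range)
      rwa [hj, sub_add_cancel] at h1
    | one =>
      intro i l
      rw [map_one, Matrix.one_apply]
      split_ifs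
      exacts [one_mem _, zero_mem _]
    | mul g g' _ _ hg hg' =>
      intro i l
      rw [map_mul, Matrix.mul_apply]
      exact sum_mem fun r _ => mul_mem (hg i r) (hg' r l)
  -- The other entries are limits of elements of the subring, which is closed.
  have hall : ∀ g i l, ∃ a, j a = τ' g i l := fun g i l =>
    mem_range_of_forall_exists_sub_mem j hinj hm fun n => by
      obtain ⟨g', hg', hn⟩ := hgen g n
      obtain ⟨a, ha⟩ := hclosure g' hg' i l
      exact ⟨a, by rw [ha]; exact hn i l⟩
  choose f hf using hall
  have hf' : ∀ g, (Matrix.of (f g)).map j = τ' g := fun g => Matrix.ext fun i l => hf g i l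
  have hmap : Function.Injective fun X : Matrix ι ι A => X.map j := Matrix.map_injective hinj
  let τ : Γ →* Matrix ι ι A :=
    { toFun := fun g => Matrix.of (f g)
      map_one' := hmap (by
        change (Matrix.of (f 1)).map j = (1 : Matrix ι ι A).map j
        rw [hf', map_one, Matrix.map_one _ (map_zero _) (map_one _)])
      map_mul' := fun g g' => hmap (by
        change (Matrix.of (f (g * g'))).map j = (Matrix.of (f g) * Matrix.of (f g')).map j
        rw [Matrix.map_mul, hf', hf', hf', map_mul]) }
  have hτ : τ.mapMatrix j = τ' := MonoidHom.ext hf'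
  refine ⟨A, j, τ, hj, hm, ⟨fun g => ?_, fun n => ?_⟩, hτ⟩
  · ext i l
    apply (algebraMap (ResidueField W) (ResidueField W')).injective
    rw [Matrix.map_apply, ← residueMap_map_eq j hj hm]
    exact (congrArg A'.residueMap (hf g i l)).trans
      (congrFun (congrFun (h.map_residueMap g) i) l)
  -- Chevalley again: congruences modulo a high power in `A'` force congruences in `A`.
  · obtain ⟨k, hk⟩ := exists_comap_maximalIdeal_pow_le j hinj n
    filter_upwards [h.continuous k] with g hg i l
    refine hk ?_
    have h1 := hg i l
    rw [← hτ] at h1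
    rw [Ideal.mem_comap, Matrix.sub_apply, map_sub]
    convert h1 using 1
    rw [Matrix.sub_apply, Matrix.one_apply, Matrix.one_apply]
    split_ifs <;> simp

end Descent

/-! ### Strict conjugacy over dual numbers. -/

section DualNumbers

variable {W : Type u} [CommRing W] [IsLocalRing W] {Γ : Type v} [Group Γ] {ι : Type} [Fintype ι]
  [DecidableEq ι]

theorem CoefficientAlgebra.exists_dualNumber_eq (a c : ResidueField W) :
    ∃ x : dualNumber W, (dualNumber W).residueMap x = a ∧ epsCoeff x = c :=
  ⟨((a, c) : DualNumber (ResidueField W)), residueMap_dualNumber _, rfl⟩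

omit [DecidableEq ι] in
theorem map_epsCoeff_mul (X Y : Matrix ι ι (dualNumber W)) :
    (X * Y).map epsCoeff = X.map (dualNumber W).residueMap * Y.map epsCoeff +
      X.map epsCoeff * Y.map (dualNumber W).residueMap := by
  ext i j
  simp only [Matrix.map_apply, Matrix.mul_apply, Matrix.add_apply, map_sum, epsCoeff_mul,
    Finset.sum_add_distrib]
  congr 1
  exact Finset.sum_congr rfl fun l _ => mul_comm _ _

/-- Strict conjugacy over the dual numbers, in terms of the cocycles. -/
theorem isStrictlyConj_dualNumber_iff {θ : Γ →* Matrix ι ι (ResidueField W)}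
    {τ τ' : Γ →* Matrix ι ι (dualNumber W)}
    (hτ : ∀ g, (τ g).map (dualNumber W).residueMap = θ g)
    (hτ' : ∀ g, (τ' g).map (dualNumber W).residueMap = θ g) :
    IsStrictlyConj τ τ' ↔ ∃ Y : Matrix ι ι (ResidueField W), ∀ g,
      (τ g).map epsCoeff + Y * θ g = θ g * Y + (τ' g).map epsCoeff := by
  constructor
  · rintro ⟨X, hX, hconj⟩
    refine ⟨X.map epsCoeff, fun g => ?_⟩
    have h := congrArg (fun Z => Matrix.map Z epsCoeff) (hconj g)
    simp only [map_epsCoeff_mul, hX, hτ, hτ', one_mul, mul_one] at h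
    exact h
  · rintro ⟨Y, hY⟩
    -- The conjugating matrix is `1 + ε Y`.
    choose X hX hX' using fun i j => exists_dualNumber_eq ((1 : Matrix ι ι (ResidueField W)) i j)
      (Y i j)
    have h1 : (Matrix.of X).map (dualNumber W).residueMap = 1 := Matrix.ext hX
    have h2 : (Matrix.of X).map epsCoeff = Y := Matrix.ext hX'
    refine ⟨Matrix.of X, h1, fun g => Matrix.ext fun i j => dualNumber_ext ?_ ?_⟩
    · have h3 : ∀ Z Z' : Matrix ι ι (dualNumber W), (Z * Z').map (dualNumber W).residueMap =
          Z.map (dualNumber W).residueMap * Z'.map (dualNumber W).residueMap := fun Z Z' =>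
        Matrix.map_mul (f := (dualNumber W).residueMap.toRingHom)
      have h4 : (Matrix.of X * τ g).map (dualNumber W).residueMap =
          (τ' g * Matrix.of X).map (dualNumber W).residueMap := by
        rw [h3, h3, h1, hτ, hτ', one_mul, mul_one]
      exact congrFun (congrFun h4 i) j
    · have h4 : (Matrix.of X * τ g).map epsCoeff = (τ' g * Matrix.of X).map epsCoeff := by
        rw [map_epsCoeff_mul, map_epsCoeff_mul, h1, h2, hτ, hτ', one_mul, mul_one, hY]
      exact congrFun (congrFun h4 i) j

end DualNumbers

/-! ### The completed tensor product and its versality. -/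

section CompletedTensorProduct

variable {W : Type u} [CommRing W] [IsLocalRing W] (W' : Type u) [CommRing W'] [IsLocalRing W']
  [Algebra W W'] [IsLocalHom (algebraMap W W')]

theorem isMaximal_tensorMaximalIdeal (R : CoefficientAlgebra W) :
    (tensorMaximalIdeal W' R).IsMaximal :=
  RingHom.ker_isMaximal_of_surjective _ fun y => by
    obtain ⟨x, rfl⟩ := residue_surjective y
    exact ⟨algebraMap W' _ x, (tensorResidueMap W' R).commutes x⟩

variable [IsNoetherianRing W']

theorem isCoefficientAlgebra_completedTensorProduct (R : CoefficientAlgebra W) :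
    IsCoefficientAlgebra W' (CompletedTensorProduct W' R) :=
  isCoefficientAlgebra_adicCompletion (tensorResidueMap W' R) (tensorMaximalIdeal_fg R)

/-- The completed tensor product as an object of `Ĉ_{W'}`. -/
noncomputable def completedTensorProduct (R : CoefficientAlgebra W) : CoefficientAlgebra W' :=
  haveI := isCoefficientAlgebra_completedTensorProduct W' R
  ⟨CompletedTensorProduct W' R⟩

/-- The canonical homomorphism from `R` to the completed tensor product. -/
noncomputable def toCompletedTensorProduct (R : CoefficientAlgebra W) :
    R →+* completedTensorProduct W' R :=
  (algebraMap (W' ⊗[W] R) (CompletedTensorProduct W' R)).comp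
    (Algebra.TensorProduct.includeRight : R →ₐ[W] W' ⊗[W] R).toRingHom

variable {W'}

theorem toCompletedTensorProduct_algebraMap (R : CoefficientAlgebra W) (w : W) :
    toCompletedTensorProduct W' R (algebraMap W R w) =
      algebraMap W' (completedTensorProduct W' R) (algebraMap W W' w) := by
  have h : (Algebra.TensorProduct.includeRight : R →ₐ[W] W' ⊗[W] R) (algebraMap W R w) =
      algebraMap W' (W' ⊗[W] R) (algebraMap W W' w) := by
    rw [AlgHom.commutes, ← IsScalarTower.algebraMap_apply]
  exact congrArg (algebraMap (W' ⊗[W] R) (CompletedTensorProduct W' R)) h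

theorem maximalIdeal_completedTensorProduct (R : CoefficientAlgebra W) :
    maximalIdeal (completedTensorProduct W' R) =
      (tensorMaximalIdeal W' R).map (algebraMap _ (CompletedTensorProduct W' R)) :=
  haveI := isMaximal_tensorMaximalIdeal W' R
  haveI := (isCoefficientAlgebra_completedTensorProduct W' R).toIsLocalRing
  maximalIdeal_adicCompletion (tensorMaximalIdeal W' R) (tensorMaximalIdeal_fg R)

theorem maximalIdeal_le_comap_toCompletedTensorProduct (R : CoefficientAlgebra W) :
    maximalIdeal R ≤
      (maximalIdeal (completedTensorProduct W' R)).comap (toCompletedTensorProduct W' R) := by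
  intro x hx
  rw [Ideal.mem_comap, maximalIdeal_completedTensorProduct]
  refine Ideal.mem_map_of_mem (algebraMap _ (CompletedTensorProduct W' R)) ?_
  change tensorResidueMap W' R (1 ⊗ₜ x) = 0
  have : R.residueMap x = 0 := (R.residueMap_eq_zero_iff x).2 hx
  simp [tensorResidueMap, this]

/-- The universal property of the completed tensor product: existence. -/
theorem exists_algHom_completedTensorProduct (R : CoefficientAlgebra W)
    (A' : CoefficientAlgebra W') (f : R →+* A')
    (hf : ∀ w, f (algebraMap W R w) = algebraMap W' A' (algebraMap W W' w))
    (hm : maximalIdeal R ≤ (maximalIdeal A').comap f) :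
    ∃ ψ : completedTensorProduct W' R →ₐ[W'] A', ∀ r, ψ (toCompletedTensorProduct W' R r) = f r := by
  let : Algebra W A' := ((algebraMap W' A').comp (algebraMap W W')).toAlgebra
  have : IsScalarTower W W' A' := .of_algebraMap_eq fun _ => rfl
  let θ : W' ⊗[W] R →ₐ[W'] A' := Algebra.TensorProduct.lift (Algebra.ofId W' A')
    ({ f with commutes' := hf } : R →ₐ[W] A') fun _ _ => Commute.all _ _
  have hθ : ∀ r, θ (1 ⊗ₜ r) = f r := fun r => by
    simp only [θ, Algebra.TensorProduct.lift_tmul, map_one, one_mul]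
    rfl
  have hθ' : A'.residueMap.comp θ = tensorResidueMap W' R := by
    refine Algebra.TensorProduct.ext (Subsingleton.elim _ _) (AlgHom.ext fun r => ?_)
    change A'.residueMap (θ (1 ⊗ₜ r)) = tensorResidueMap W' R (1 ⊗ₜ r)
    rw [hθ, residueMap_map_eq f hf hm]
    simp [tensorResidueMap]
  have hle : tensorMaximalIdeal W' R ≤ (maximalIdeal A').comap θ.toRingHom := fun x hx => by
    rw [Ideal.mem_comap, ← residueMap_eq_zero_iff]
    exact (DFunLike.congr_fun hθ' x).trans hx
  obtain ⟨ψ, hψ⟩ := AdicCompletion.exists_ringHom_extending θ.toRingHom hle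
  refine ⟨{ ψ with commutes' := fun w => ?_ }, fun r => (hψ _).trans (hθ r)⟩
  exact (hψ (algebraMap W' _ w)).trans (θ.commutes w)

/-- The universal property of the completed tensor product: uniqueness. -/
theorem algHom_completedTensorProduct_ext {R : CoefficientAlgebra W} {A' : CoefficientAlgebra W'}
    {α β : completedTensorProduct W' R →ₐ[W'] A'}
    (h : ∀ r, α (toCompletedTensorProduct W' R r) = β (toCompletedTensorProduct W' R r)) :
    α = β := by
  have h1 : ∀ x : W' ⊗[W] R, α (algebraMap (W' ⊗[W] R) (CompletedTensorProduct W' R) x) =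
      β (algebraMap (W' ⊗[W] R) (CompletedTensorProduct W' R) x) := by
    intro x
    induction x with
    | zero => rw [map_zero]; exact (map_zero α).trans (map_zero β).symm
    | add x y hx hy =>
      rw [map_add]
      exact (map_add α _ _).trans ((congrArg₂ _ hx hy).trans (map_add β _ _).symm)
    | tmul a r =>
      have e : algebraMap (W' ⊗[W] R) (CompletedTensorProduct W' R) (a ⊗ₜ r) =
          algebraMap W' (completedTensorProduct W' R) a * toCompletedTensorProduct W' R r := by
        have : a ⊗ₜ[W] r = algebraMap W' (W' ⊗[W] R) a * (1 ⊗ₜ r) := by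
          simp [Algebra.TensorProduct.algebraMap_apply]
        rw [this, map_mul]
        rfl
      rw [e]
      refine (map_mul α _ _).trans (Eq.trans ?_ (map_mul β _ _).symm)
      rw [h, AlgHom.commutes, AlgHom.commutes]
  have h2 : α.toRingHom = β.toRingHom :=
    AdicCompletion.ringHom_ext_of_isHausdorff (J := maximalIdeal A') (tensorMaximalIdeal_fg R)
      (ψ := α.toRingHom) (ψ' := β.toRingHom)
      (fun x hx => map_mem_maximalIdeal α (by
        rw [maximalIdeal_completedTensorProduct]
        exact Ideal.mem_map_of_mem _ hx)) h1
  exact AlgHom.ext fun x => DFunLike.congr_fun h2 x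

variable {Γ : Type v} [Group Γ] {ι : Type} [Fintype ι] [DecidableEq ι]

/-- Injectivity of the map to deformations over the dual numbers is preserved by a change of
coefficients. -/
theorem algHom_dualNumber_eq_of_isStrictlyConj [TopologicalSpace Γ] {R : CoefficientAlgebra W}
    {θ : Γ →* Matrix ι ι (ResidueField W)} {τ : Γ →* Matrix ι ι R} (hτ : IsFramedLift θ R τ)
    (hi : ∀ α β : R →ₐ[W] dualNumber W,
      IsStrictlyConj (τ.mapMatrix α.toRingHom) (τ.mapMatrix β.toRingHom) → α = β)
    (α β : completedTensorProduct W' R →ₐ[W'] dualNumber W')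
    (h : IsStrictlyConj ((τ.mapMatrix (toCompletedTensorProduct W' R)).mapMatrix α.toRingHom)
      ((τ.mapMatrix (toCompletedTensorProduct W' R)).mapMatrix β.toRingHom)) : α = β := by
  have hτ' := hτ.map_of_ringHom (toCompletedTensorProduct W' R)
    (toCompletedTensorProduct_algebraMap R) (maximalIdeal_le_comap_toCompletedTensorProduct R)
  obtain ⟨Y, hY⟩ := (isStrictlyConj_dualNumber_iff (hτ'.map α).map_residueMap
    (hτ'.map β).map_residueMap).1 h
  have hres : ∀ (γ : completedTensorProduct W' R →ₐ[W'] dualNumber W') (r : R),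
      (dualNumber W').residueMap (γ (toCompletedTensorProduct W' R r)) =
        algebraMap (ResidueField W) (ResidueField W') (R.residueMap r) := fun γ r => by
    rw [residueMap_comp, residueMap_map_eq _ (toCompletedTensorProduct_algebraMap R)
      (maximalIdeal_le_comap_toCompletedTensorProduct R)]
  -- No finiteness of `k'` over `k` is available, so the `k'`-valued derivations are tested on all
  -- `k`-linear functionals `k' → k`.
  have key : ∀ (l : Module.Dual (ResidueField W) (ResidueField W')) (r : R),
      l (epsCoeff (α (toCompletedTensorProduct W' R r)) -
        epsCoeff (β (toCompletedTensorProduct W' R r))) = 0 := by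
    intro l r
    let D : (completedTensorProduct W' R →ₐ[W'] dualNumber W') → R →+ ResidueField W := fun γ =>
      (l.toAddMonoidHom.comp epsCoeff).comp
        (γ.toRingHom.comp (toCompletedTensorProduct W' R)).toAddMonoidHom
    have hD : ∀ γ r, D γ r = l (epsCoeff (γ (toCompletedTensorProduct W' R r))) := fun _ _ => rfl
    let F : (completedTensorProduct W' R →ₐ[W'] dualNumber W') → (R →ₐ[W] dualNumber W) := fun γ =>
      R.dualNumberHom (D γ) (fun a b => by
        rw [hD, hD, hD, map_mul, map_mul, epsCoeff_mul, hres, hres, ← Algebra.smul_def,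
          ← Algebra.smul_def, map_add, map_smul, map_smul]
        rfl) fun w => by
        rw [hD, toCompletedTensorProduct_algebraMap, AlgHom.commutes, epsCoeff_algebraMap, map_zero]
    have hF : ∀ γ g, ((τ.mapMatrix (F γ).toRingHom) g).map epsCoeff =
        ((((τ.mapMatrix (toCompletedTensorProduct W' R)).mapMatrix γ.toRingHom) g).map
          epsCoeff).map l := fun γ g => rfl
    have hl : ∀ X : Matrix ι ι (ResidueField W), ∀ Z : Matrix ι ι (ResidueField W'),
        (X.map (algebraMap (ResidueField W) (ResidueField W')) * Z).map l = X * Z.map l := by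
      intro X Z
      ext i j
      simp only [Matrix.map_apply, Matrix.mul_apply, map_sum, ← Algebra.smul_def, map_smul,
        smul_eq_mul]
    have hl' : ∀ X : Matrix ι ι (ResidueField W), ∀ Z : Matrix ι ι (ResidueField W'),
        (Z * X.map (algebraMap (ResidueField W) (ResidueField W'))).map l = Z.map l * X := by
      intro X Z
      ext i j
      simp only [Matrix.map_apply, Matrix.mul_apply, map_sum, mul_comm (Z i _),
        ← Algebra.smul_def, map_smul, smul_eq_mul, mul_comm (X _ j)]
    -- The cocycle relation involves `θ` only through entries in `k`, so applying `l` entrywise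
    -- gives the relation for `F α` and `F β`, with conjugating matrix `Y.map l`.
    have hconj : IsStrictlyConj (τ.mapMatrix (F α).toRingHom) (τ.mapMatrix (F β).toRingHom) := by
      refine (isStrictlyConj_dualNumber_iff (hτ.map (F α)).map_residueMap
        (hτ.map (F β)).map_residueMap).2 ⟨Y.map l, fun g => ?_⟩
      have h1 := congrArg (fun Z => Matrix.map Z l) (hY g)
      simp only [Matrix.map_add l (map_add l), MonoidHom.mapMatrix_apply _ θ, hl, hl'] at h1
      rw [hF, hF]
      exact h1
    have h1 := congrArg epsCoeff (DFunLike.congr_fun (hi _ _ hconj) r)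
    have h2 : D α r = D β r := h1
    rw [map_sub, sub_eq_zero]
    exact h2
  refine algHom_completedTensorProduct_ext fun r => dualNumber_ext ((hres α r).trans
    (hres β r).symm) ?_
  exact sub_eq_zero.1
    ((Module.forall_dual_apply_eq_zero_iff (ResidueField W) _).1 fun l => key l r)

/-- The completed tensor product of a versal deformation ring is versal. -/
theorem IsVersalDeformationRing.completedTensorProduct {p : ℕ} [Fact p.Prime]
    [TopologicalSpace Γ] [IsTopologicalGroup Γ] [CompactSpace Γ] (hΓ : IsPFinite p Γ)
    [IsNoetherianRing W] [CharP (ResidueField W) p] {V : Type w} [AddCommGroup V]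
    [Module (ResidueField W) V] [FiniteDimensional (ResidueField W) V]
    {ρ : Representation (ResidueField W) Γ V} {R : CoefficientAlgebra W}
    (hR : IsVersalDeformationRing ρ R) :
    IsVersalDeformationRing (ρ.extendScalars (ResidueField W'))
      (completedTensorProduct W' R) := by
  have : CharP (ResidueField W') p :=
    charP_of_injective_algebraMap (algebraMap (ResidueField W) (ResidueField W')).injective p
  let b := Module.finBasis (ResidueField W) V
  have hb : (ρ.extendScalars (ResidueField W')).matrixHom (b.baseChange (ResidueField W')) =
      (ρ.matrixHom b).mapMatrix (algebraMap (ResidueField W) (ResidueField W')) := by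
    ext g i j
    rw [Representation.matrixHom_apply_apply, MonoidHom.mapMatrix_apply, Matrix.map_apply,
      Representation.matrixHom_apply_apply]
    have h1 : ρ.extendScalars (ResidueField W') g (b.baseChange (ResidueField W') j) =
        1 ⊗ₜ ρ g (b j) := by
      rw [Module.Basis.baseChange_apply]; rfl
    rw [h1, Module.Basis.baseChange_repr_tmul, Algebra.smul_def, mul_one]
  obtain ⟨τ, hτ, hs, hi⟩ := (isVersalDeformationRing_iff ρ b R).1 hR
  refine (isVersalDeformationRing_iff _ (b.baseChange (ResidueField W')) _).2
    ⟨τ.mapMatrix (toCompletedTensorProduct W' R), ?_, fun A' τ' hτ' => ?_,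
      algHom_dualNumber_eq_of_isStrictlyConj hτ hi⟩
  · rw [hb]
    exact hτ.map_of_ringHom _ (toCompletedTensorProduct_algebraMap R)
      (maximalIdeal_le_comap_toCompletedTensorProduct R)
  · rw [hb] at hτ'
    -- Versality of `R` is applied to the descended lift over `A`; the resulting map `R → A → A'`
    -- then extends to the completion.
    obtain ⟨A, j, τA, hj, hm, hτA, rfl⟩ := hτ'.exists_descent hΓ
    obtain ⟨α, hα⟩ := hs A τA hτA
    obtain ⟨ψ, hψ⟩ := exists_algHom_completedTensorProduct R A' (j.comp α.toRingHom)
      (fun w => (congrArg j (α.commutes w)).trans (hj w))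
      (fun x hx => hm (map_mem_maximalIdeal α hx))
    refine ⟨ψ, ?_⟩
    have h1 : (τ.mapMatrix (toCompletedTensorProduct W' R)).mapMatrix ψ.toRingHom =
        (τ.mapMatrix α.toRingHom).mapMatrix j :=
      MonoidHom.ext fun g => Matrix.ext fun i l => hψ (τ g i l)
    rw [h1]
    exact hα.map j hm

end CompletedTensorProduct

theorem theorem2p1 {p : ℕ} [Fact p.Prime]
    {Γ : Type v} [Group Γ] [TopologicalSpace Γ] [IsTopologicalGroup Γ] [CompactSpace Γ]
    [T2Space Γ] [TotallyDisconnectedSpace Γ] (hΓ : IsPFinite p Γ)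
    {W : Type u} [CommRing W] [IsLocalRing W] [IsNoetherianRing W]
    [IsAdicComplete (maximalIdeal W) W] [CharP (ResidueField W) p]
    {W' : Type u} [CommRing W'] [IsLocalRing W'] [IsNoetherianRing W']
    [IsAdicComplete (maximalIdeal W') W'] [Algebra W W'] [IsLocalHom (algebraMap W W')]
    {V : Type w} [AddCommGroup V] [Module (ResidueField W) V] [FiniteDimensional (ResidueField W) V]
    (ρ : Representation (ResidueField W) Γ V)
    (hρ : @Continuous Γ (Module.End (ResidueField W) V) _ ⊥ ρ)
    (R : CoefficientAlgebra W) (hR : IsVersalDeformationRing ρ R) :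
    IsCoefficientAlgebra W' (CompletedTensorProduct W' R) ∧
      ∀ R' : CoefficientAlgebra W',
        IsVersalDeformationRing (ρ.extendScalars (ResidueField W')) R' ↔
          Nonempty (R' ≃ₐ[W'] CompletedTensorProduct W' R) := by
  refine ⟨isCoefficientAlgebra_completedTensorProduct W' R, fun R' => ?_⟩
  have hC := hR.completedTensorProduct (W' := W') hΓ
  exact ⟨fun hR' => hR'.nonempty_algEquiv hC, fun ⟨e⟩ => hC.of_algEquiv (R₂ := R') e.symm⟩
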